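/- For $\zeta>0$ let $K(\zeta)$ be the integral operator on $L^2(-1,1)$ with kernel $\frac{\sin \zeta\pi(x-t)}{\pi(x-t)}$ (equal to $\zeta$ at $x=t$), and let $$P(\zeta,1)=\det(I-K(\zeta))=\sum_{n=0}^{\infty}\frac{(-1)^n}{n!}\int_{[-1,1]^n}\det\Big[\tfrac{\sin \zeta\pi(x_i-x_j)}{\pi(x_i-x_j)}\Big]_{i,j=1}^n\,dx_1\cdots dx_n$$ be its Fredholm determinant. On $L^2(-\zeta,\zeta)$ put $(C_\zeta f)(x)=f(x)-\int_{-\zeta}^{\zeta}\frac{\sin\pi(x-y)}{\pi(x-y)}f(y)\,dy$ (the kernel being $1$ at $x=y$). Then $C_\zeta$ is invertible and its inverse has the form $(C_\zeta^{-1}f)(x)=f(x)+\int_{-\zeta}^{\zeta}Q_\zeta(x,y)f(y)\,dy$ with $Q_\zeta$ continuous on $[-\zeta,\zeta]^2$. With $$r(\zeta)=e^{i\pi\zeta}+\int_{-\zeta}^{\zeta}Q_\zeta(-\zeta,s)e^{-i\pi s}\,ds,$$ for every $\zeta>0$ one has $P(\zeta,1)>0$, the function $\log P(\cdot,1)$ is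 differentiable at $\zeta$, the function $|r^2|$ is integrable on $(0,\zeta)$, and $$\zeta\,\frac{d}{d\zeta}\log P(\zeta,1)=-2\int_0^{\zeta}|r^2(s)|\,ds .$$ -/

import Mathlib

open MeasureTheory

/-- The Fredholm determinant `det (I - lam K)` of the integral operator `K` on `L²(a, b)` with
continuous kernel `k`, given by Fredholm's series
`∑ₙ ((-lam)ⁿ / n!) ∫_{[a,b]ⁿ} det (k (xᵢ, xⱼ)) dx₁ … dxₙ`. -/
noncomputable def fredholmDet (a b : ℝ) (k : ℝ → ℝ → ℝ) (lam : ℝ) : ℝ :=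
  ∑' n : ℕ, ((-lam) ^ n / (n.factorial : ℝ)) *
    ∫ x in (Set.univ : Set (Fin n)).pi (fun _ => Set.Icc a b),
      (Matrix.of fun i j : Fin n => k (x i) (x j)).det

/-- The kernel `sin (ζ π (x - t)) / (π (x - t))`, with its continuous value `ζ` at `x = t`. -/
noncomputable def sineKernel (ζ x t : ℝ) : ℝ :=
  ζ * Real.sinc (ζ * Real.pi * (x - t))

/-- `P(ζ, lam) = det (I - lam K(ζ))`, where `K(ζ)` is the operator on `L²(-1, 1)` with kernel
`sin (ζ π (x - t)) / (π (x - t))`. -/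
noncomputable def sineDet (ζ lam : ℝ) : ℝ :=
  fredholmDet (-1) 1 (sineKernel ζ) lam

/-- The integral operator `(K f)(x) = ∫_{-ζ}^{ζ} k(x, y) f(y) dy`, on complex functions. -/
noncomputable def intOp (ζ : ℝ) (k : ℝ → ℝ → ℂ) (f : ℝ → ℂ) (x : ℝ) : ℂ :=
  ∫ y in (-ζ)..ζ, k x y * f y

/-- The operator `(C_ζ f)(x) = f(x) - ∫_{-ζ}^{ζ} k(x - y) f(y) dy` with
`k(x) = sin (π x) / (π x)`, `k(0) = 1`. -/
noncomputable def sineOp (ζ : ℝ) (f : ℝ → ℂ) (x : ℝ) : ℂ :=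
  f x - intOp ζ (fun x y => (Real.sinc (Real.pi * (x - y)) : ℂ)) f x

/-- `Q` is the resolvent kernel of `C_ζ`: it is continuous on `[-ζ, ζ]²`, and
`f ↦ f(x) + ∫_{-ζ}^{ζ} Q(x, y) f(y) dy` is the two-sided inverse of `C_ζ` on `L²(-ζ, ζ)`
(functions in `L²` being identified when they agree almost everywhere). -/
structure IsSineResolventKernel (ζ : ℝ) (Q : ℝ → ℝ → ℂ) : Prop where
  continuousOn : ContinuousOn (fun p : ℝ × ℝ => Q p.1 p.2)
    (Set.Icc (-ζ) ζ ×ˢ Set.Icc (-ζ) ζ)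
  right_inv : ∀ f : ℝ → ℂ, MemLp f 2 (volume.restrict (Set.Icc (-ζ) ζ)) →
    ∀ᵐ x ∂(volume.restrict (Set.Icc (-ζ) ζ)),
      sineOp ζ (fun y => f y + intOp ζ Q f y) x = f x
  left_inv : ∀ f : ℝ → ℂ, MemLp f 2 (volume.restrict (Set.Icc (-ζ) ζ)) →
    ∀ᵐ x ∂(volume.restrict (Set.Icc (-ζ) ζ)),
      sineOp ζ f x + intOp ζ Q (sineOp ζ f) x = f x

open Classical in
/-- The resolvent kernel `Q_ζ` of `C_ζ`. The two-sided inverse is unique and `Q_ζ` is continuous,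
so its values on `[-ζ, ζ]²` do not depend on the choice; it is `0` if there is no such kernel. -/
noncomputable def sineResolvent (ζ : ℝ) : ℝ → ℝ → ℂ :=
  if h : ∃ Q : ℝ → ℝ → ℂ, IsSineResolventKernel ζ Q then h.choose else fun _ _ => 0

/-- `r(ζ) = e^{iπζ} + ∫_{-ζ}^{ζ} Q_ζ(-ζ, s) e^{-iπs} ds`. -/
noncomputable def sineR (ζ : ℝ) : ℂ :=
  Complex.exp (Complex.I * ζ * Real.pi) +
    ∫ s in (-ζ)..ζ, sineResolvent ζ (-ζ) s * Complex.exp (-(Complex.I * s * Real.pi))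

/-! Two facts combine at the left endpoint. Write `A(z)` for the operator on the fixed interval
`[-1, 1]` with kernel `sin zπ(x-t) / (π(x-t))`, and `T_z` for its resolvent kernel, so that `(1 -
A(z))⁻¹ = 1 + T_z`.

(1) The kernel is the integral of `cos wπ(x-t)` over `0 < w < z`, hence `A'(z) = c ⊗ c + s ⊗ s` with
`c = cos zπ·` and `s = sin zπ·`. Differentiating the inverse, the derivative of `T_z(y, y)` is the
sum of the squares of `(1 - A)⁻¹c` and `(1 - A)⁻¹s` at `y` (`hasDerivAt_resolventSection_diag`). At
`y = -1` this is `|r(z)²|` (`sineR_eq`, `norm_sineR_sq`). As `T_0 = 0`, it follows that `T_z(-1, -1)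
= ∫₀^z |r²|`.

(2) After scaling, `P(z, 1)` is the determinant `D(z)` of the kernel `sin π(x-y) / (π(x-y))` on
`[-z, z]`. Moving both endpoints changes it at the rate `-2` times the first minor at `(-z, -z)`.
This is read off Fredholm's series by cutting each cube according to the coordinate of largest
modulus (`setIntegral_cube_symmetric`, `fredholmDet_eq_one_sub_integral`). The minor is `D(z)
Q_z(-z, -z)` (`fredholmMinor_unitSine`), and `z Q_z(-z, -z) = T_z(-1, -1)`.

Thus `D' = -2 Q_z(-z, -z) D` with `D(0) = 1`, which gives positivity and the formula. Invertibility
of `1 - A(z)` follows from the Fredholm alternative: a fixed function would have a Fourier transform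
vanishing beyond `z`, but that transform is entire (`eq_zero_of_sineOperator_apply_eq`). -/

namespace SineKernel

open MeasureTheory Set Filter Topology

/-! ### Continuous functions on `[-1, 1]` -/

/-- The interval `[-1, 1]`. -/
abbrev 𝕁 : Set ℝ := Icc (-1) 1

noncomputable instance : MeasureSpace 𝕁 := Measure.Subtype.measureSpace

theorem integral_interval_eq {F : Type*} [NormedAddCommGroup F] [NormedSpace ℝ F] (f : ℝ → F) :
    ∫ x : 𝕁, f x = ∫ x in (-1 : ℝ)..1, f x := by
  rw [intervalIntegral.integral_of_le (by norm_num), ← integral_Icc_eq_integral_Ioc]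
  exact integral_subtype_comap measurableSet_Icc f

instance : IsFiniteMeasure (volume : Measure 𝕁) :=
  ⟨by
    rw [show (volume : Measure 𝕁) = Measure.comap Subtype.val volume from rfl,
      comap_subtype_coe_apply measurableSet_Icc, image_univ, Subtype.range_coe]
    exact isCompact_Icc.measure_lt_top⟩

/-- The Banach algebra of continuous functions on `[-1, 1]`. -/
def IntervalFun : Type := C(𝕁, ℝ)

noncomputable instance : NormedCommRing IntervalFun := inferInstanceAs (NormedCommRing C(𝕁, ℝ))
noncomputable instance : NormedAlgebra ℝ IntervalFun := inferInstanceAs (NormedAlgebra ℝ C(𝕁, ℝ))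
instance : CompleteSpace IntervalFun := inferInstanceAs (CompleteSpace C(𝕁, ℝ))
instance : FunLike IntervalFun 𝕁 ℝ := inferInstanceAs (FunLike C(𝕁, ℝ) 𝕁 ℝ)
instance : ContinuousMapClass IntervalFun 𝕁 ℝ :=
  inferInstanceAs (ContinuousMapClass C(𝕁, ℝ) 𝕁 ℝ)

namespace IntervalFun

@[ext] theorem ext {f g : IntervalFun} (h : ∀ x, f x = g x) : f = g := DFunLike.ext f g h
@[simp] protected theorem zero_apply (x : 𝕁) : (0 : IntervalFun) x = 0 := rfl
@[simp] protected theorem add_apply (f g : IntervalFun) (x : 𝕁) : (f + g) x = f x + g x := rfl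
@[simp] protected theorem neg_apply (f : IntervalFun) (x : 𝕁) : (-f) x = -f x := rfl
@[simp] protected theorem smul_apply (a : ℝ) (f : IntervalFun) (x : 𝕁) : (a • f) x = a * f x := rfl

theorem abs_apply_le (f : IntervalFun) (x : 𝕁) : |f x| ≤ ‖f‖ :=
  ContinuousMap.norm_coe_le_norm (show C(𝕁, ℝ) from f) x

theorem integrable (f : IntervalFun) : Integrable (fun x => f x) :=
  (map_continuous f).integrable_of_hasCompactSupport (HasCompactSupport.of_compactSpace _)

/-- Evaluation at a point. -/
noncomputable def eval (x : 𝕁) : IntervalFun →L[ℝ] ℝ :=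
  LinearMap.mkContinuous
    { toFun := fun f => f x
      map_add' := fun _ _ => rfl
      map_smul' := fun _ _ => rfl } 1 (fun f => by
      rw [one_mul]
      exact f.abs_apply_le x)

@[simp] theorem eval_apply (x : 𝕁) (f : IntervalFun) : eval x f = f x := rfl

theorem continuous_apply : Continuous fun p : IntervalFun × 𝕁 => p.1 p.2 :=
  ContinuousEval.continuous_eval (F := C(𝕁, ℝ))

/-- The curve in `IntervalFun` given by a continuous function of two variables. -/
def curry {Y : Type*} [TopologicalSpace Y] (F : C(Y × 𝕁, ℝ)) : Y → IntervalFun :=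
  fun y => ContinuousMap.curry F y

theorem continuous_curry {Y : Type*} [TopologicalSpace Y] (F : C(Y × 𝕁, ℝ)) :
    Continuous (curry F) :=
  (ContinuousMap.curry F).continuous

/-- Integration over `[-1, 1]` as a continuous linear functional. -/
noncomputable def integral : IntervalFun →L[ℝ] ℝ :=
  LinearMap.mkContinuous
    { toFun := fun f => ∫ x, f x
      map_add' := fun f g => by simpa using integral_add f.integrable g.integrable
      map_smul' := fun a f => by simp [integral_const_mul] }
    ((volume : Measure 𝕁).real univ) (fun f => by
      rw [mul_comm]
      exact norm_integral_le_of_norm_le_const (Eventually.of_forall f.abs_apply_le))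

/-- The bilinear form `∫ f g`. -/
noncomputable def pairing : IntervalFun →L[ℝ] IntervalFun →L[ℝ] ℝ :=
  (ContinuousLinearMap.compL ℝ IntervalFun IntervalFun ℝ integral).comp
    (ContinuousLinearMap.mul ℝ IntervalFun)

theorem pairing_apply (f g : IntervalFun) : pairing f g = ∫ x, f x * g x := rfl

theorem pairing_comm (f g : IntervalFun) : pairing f g = pairing g f := by
  simp only [pairing_apply, mul_comm]

theorem eq_zero_of_pairing_self {f : IntervalFun} (h : pairing f f = 0) : f = 0 := by
  let g : ℝ → ℝ := fun x => f (projIcc (-1) 1 (by norm_num) x)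
  have hg : Continuous g := (map_continuous f).comp continuous_projIcc
  have h1 : ∫ x in (-1 : ℝ)..1, g x * g x = 0 := by
    rw [← integral_interval_eq, ← h, pairing_apply]
    simp [g]
  ext x
  by_contra hx
  have hpos : 0 < ∫ x in (-1 : ℝ)..1, g x * g x :=
    intervalIntegral.integral_pos (by norm_num) (hg.mul hg).continuousOn
      (fun y _ => mul_self_nonneg _) ⟨x, x.2, by
        have : g x = f x := by simp [g]
        rw [this]
        exact mul_self_pos.2 hx⟩
  exact hpos.ne' h1

/-- The operator `g ↦ (∫ f g) f`. -/
noncomputable def rankOne (f : IntervalFun) : IntervalFun →L[ℝ] IntervalFun :=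
  (pairing f).smulRight f

@[simp] theorem rankOne_apply (f g : IntervalFun) : rankOne f g = pairing f g • f := rfl

theorem continuous_rankOne : Continuous rankOne := by
  have : rankOne = fun f =>
      ContinuousLinearMap.smulRightL ℝ IntervalFun IntervalFun (pairing f) f := rfl
  rw [this]
  fun_prop

/-- It factors through `ℝ`, where the identity is compact. -/
theorem isCompactOperator_rankOne (f : IntervalFun) : IsCompactOperator (rankOne f) :=
  ((isCompactOperator_id (E := ℝ)).comp_clm (pairing f)).clm_comp
    ((ContinuousLinearMap.id ℝ ℝ).smulRight f)

end IntervalFun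

open IntervalFun

/-! ### The operator with the sine kernel on `C([-1, 1])` -/

/-- The curve `z ↦ cos (z π ·)` in `C([-1, 1])`. -/
noncomputable def cosCurve : ℝ → IntervalFun :=
  curry ⟨fun p : ℝ × 𝕁 => Real.cos (p.1 * Real.pi * p.2), by fun_prop⟩

/-- The curve `z ↦ sin (z π ·)` in `C([-1, 1])`. -/
noncomputable def sinCurve : ℝ → IntervalFun :=
  curry ⟨fun p : ℝ × 𝕁 => Real.sin (p.1 * Real.pi * p.2), by fun_prop⟩

/-- The map `x ↦ sineKernel z x ·` into `C([-1, 1])`. -/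
noncomputable def kernelSection (z : ℝ) : 𝕁 → IntervalFun :=
  curry ⟨fun p : 𝕁 × 𝕁 => sineKernel z p.1 p.2, by
    unfold sineKernel
    have := Real.continuous_sinc
    fun_prop⟩

@[fun_prop] theorem continuous_cosCurve : Continuous cosCurve := continuous_curry _
@[fun_prop] theorem continuous_sinCurve : Continuous sinCurve := continuous_curry _
theorem continuous_kernelSection (z : ℝ) : Continuous (kernelSection z) := continuous_curry _

@[simp] theorem cosCurve_apply (z : ℝ) (t : 𝕁) : cosCurve z t = Real.cos (z * Real.pi * t) := rfl
@[simp] theorem sinCurve_apply (z : ℝ) (t : 𝕁) : sinCurve z t = Real.sin (z * Real.pi * t) := rfl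
theorem kernelSection_apply (z : ℝ) (x t : 𝕁) : kernelSection z x t = sineKernel z x t := rfl

theorem continuous_rankOne_curves :
    Continuous fun w : ℝ => rankOne (cosCurve w) + rankOne (sinCurve w) :=
  (continuous_rankOne.comp continuous_cosCurve).add (continuous_rankOne.comp continuous_sinCurve)

/-- The integral operator with kernel `sineKernel z` on `C([-1, 1])`, as an integral of operators
of rank one. -/
noncomputable def sineOperator (z : ℝ) : IntervalFun →L[ℝ] IntervalFun :=
  ∫ w in (0 : ℝ)..z, (rankOne (cosCurve w) + rankOne (sinCurve w))

/-- The reason for defining the operator as an integral over frequencies: the fundamental theorem of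
calculus gives a derivative of rank at most two, in operator norm. -/
theorem hasDerivAt_sineOperator (z : ℝ) :
    HasDerivAt sineOperator (rankOne (cosCurve z) + rankOne (sinCurve z)) z :=
  continuous_rankOne_curves.integral_hasStrictDerivAt 0 z |>.hasDerivAt

theorem integral_cos_mul_pi (z u : ℝ) :
    ∫ w in (0 : ℝ)..z, Real.cos (w * (Real.pi * u)) = z * Real.sinc (z * Real.pi * u) := by
  rcases eq_or_ne u 0 with rfl | hu
  · simp
  rcases eq_or_ne z 0 with rfl | hz
  · simp
  have hpi := Real.pi_ne_zero
  rw [intervalIntegral.integral_comp_mul_right _ (mul_ne_zero hpi hu), integral_cos,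
    Real.sinc_of_ne_zero (by positivity)]
  simp only [zero_mul, Real.sin_zero, sub_zero, smul_eq_mul]
  rw [← mul_assoc z]
  field_simp

theorem continuous_kernelSection_deriv (x : 𝕁) : Continuous fun w : ℝ =>
    cosCurve w x • cosCurve w + sinCurve w x • sinCurve w := by
  simp only [cosCurve_apply, sinCurve_apply]
  fun_prop

theorem kernelSection_eq_integral (z : ℝ) (x : 𝕁) :
    kernelSection z x =
      ∫ w in (0 : ℝ)..z, (cosCurve w x • cosCurve w + sinCurve w x • sinCurve w) := by
  ext t
  have h := (eval t).intervalIntegral_comp_comm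
    ((continuous_kernelSection_deriv x).intervalIntegrable (μ := volume) 0 z)
  simp only [eval_apply] at h
  rw [← h, kernelSection_apply, sineKernel, ← integral_cos_mul_pi]
  refine intervalIntegral.integral_congr fun w _ => ?_
  simp only [IntervalFun.add_apply, IntervalFun.smul_apply, cosCurve_apply, sinCurve_apply]
  rw [← Real.cos_sub]
  ring_nf

theorem hasDerivAt_kernelSection (z : ℝ) (x : 𝕁) :
    HasDerivAt (fun z => kernelSection z x)
      (cosCurve z x • cosCurve z + sinCurve z x • sinCurve z) z := by
  simp only [kernelSection_eq_integral]
  exact ((continuous_kernelSection_deriv x).integral_hasStrictDerivAt 0 z).hasDerivAt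

theorem continuous_pairing_curves (f : IntervalFun) : Continuous fun w : ℝ =>
    pairing (cosCurve w) f • cosCurve w + pairing (sinCurve w) f • sinCurve w := by
  fun_prop

theorem sineOperator_apply (z : ℝ) (f : IntervalFun) :
    sineOperator z f = ∫ w in (0 : ℝ)..z,
      (pairing (cosCurve w) f • cosCurve w + pairing (sinCurve w) f • sinCurve w) :=
  ((ContinuousLinearMap.apply ℝ IntervalFun f).intervalIntegral_comp_comm
    (continuous_rankOne_curves.intervalIntegrable (μ := volume) 0 z)).symm

/-- Evaluation at `x` and pairing with `f` both commute with the integral over frequencies, which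
identifies the operator-valued integral with the integral operator of the sine kernel. -/
theorem sineOperator_apply_apply (z : ℝ) (f : IntervalFun) (x : 𝕁) :
    sineOperator z f x = pairing (kernelSection z x) f := by
  have h := (eval x).intervalIntegral_comp_comm
    ((continuous_pairing_curves f).intervalIntegrable (μ := volume) 0 z)
  have h2 := (pairing.flip f).intervalIntegral_comp_comm
    ((continuous_kernelSection_deriv x).intervalIntegrable (μ := volume) 0 z)
  rw [← kernelSection_eq_integral, ContinuousLinearMap.flip_apply] at h2
  rw [← sineOperator_apply, eval_apply] at h
  rw [← h, ← h2]
  refine intervalIntegral.integral_congr fun w _ => ?_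
  simp [mul_comm]

theorem pairing_sineOperator (z : ℝ) (f g : IntervalFun) :
    pairing (sineOperator z f) g = ∫ w in (0 : ℝ)..z,
      (pairing (cosCurve w) f * pairing (cosCurve w) g +
        pairing (sinCurve w) f * pairing (sinCurve w) g) := by
  have h := (pairing.flip g).intervalIntegral_comp_comm
    ((continuous_pairing_curves f).intervalIntegrable (μ := volume) 0 z)
  rw [← sineOperator_apply, ContinuousLinearMap.flip_apply] at h
  rw [← h]
  simp

theorem pairing_sineOperator_comm (z : ℝ) (f g : IntervalFun) :
    pairing (sineOperator z f) g = pairing f (sineOperator z g) := by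
  rw [pairing_comm f, pairing_sineOperator, pairing_sineOperator]
  simp only [mul_comm]

/-- Compact operators form a closed subspace, so it contains the averages of a continuous family of
finite-rank operators, and an integral is a multiple of an average. -/
theorem isCompactOperator_sineOperator (z : ℝ) : IsCompactOperator (sineOperator z) := by
  let S := compactOperator (RingHom.id ℝ) IntervalFun IntervalFun
  have hS : IsClosed (S : Set (IntervalFun →L[ℝ] IntervalFun)) :=
    isClosed_setOfPred_isCompactOperator
  have hF : ∀ w, rankOne (cosCurve w) + rankOne (sinCurve w) ∈ S := fun w =>
    (isCompactOperator_rankOne _).add (isCompactOperator_rankOne _)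
  have key : ∀ a b : ℝ, a ≤ b →
      ∫ w in a..b, (rankOne (cosCurve w) + rankOne (sinCurve w)) ∈ S := by
    intro a b hab
    rcases hab.eq_or_lt with rfl | hab
    · simp
    rw [intervalIntegral.integral_of_le hab.le, ← measure_smul_setAverage _ (by simp)]
    refine S.smul_mem _ (S.convex.set_average_mem hS (by simpa using hab) (by simp)
      (Eventually.of_forall hF) ?_)
    exact (continuous_rankOne_curves.intervalIntegrable a b).1
  rcases le_total 0 z with h | h
  · exact key 0 z h
  · have hz : sineOperator z = -∫ w in z..0, (rankOne (cosCurve w) + rankOne (sinCurve w)) :=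
      intervalIntegral.integral_symm _ _
    change sineOperator z ∈ S
    rw [hz]
    exact S.neg_mem (key z 0 h)

open IntervalFun

/-! ### Invertibility of `1 - sineOperator z` -/

/-- The squared modulus of the Fourier transform of `f` at the frequency `w / 2`. -/
noncomputable def spectralDensity (f : IntervalFun) (w : ℝ) : ℝ :=
  pairing (cosCurve w) f ^ 2 + pairing (sinCurve w) f ^ 2

theorem continuous_spectralDensity (f : IntervalFun) : Continuous (spectralDensity f) := by
  unfold spectralDensity
  fun_prop

theorem spectralDensity_nonneg (f : IntervalFun) (w : ℝ) : 0 ≤ spectralDensity f w := by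
  unfold spectralDensity
  positivity

theorem spectralDensity_neg (f : IntervalFun) (w : ℝ) :
    spectralDensity f (-w) = spectralDensity f w := by
  have h1 : cosCurve (-w) = cosCurve w := by
    ext x
    simp [Real.cos_neg]
  have h2 : sinCurve (-w) = (-1 : ℝ) • sinCurve w := by
    ext x
    simp [Real.sin_neg]
  simp [spectralDensity, h1, h2]

theorem pairing_sineOperator_self (z : ℝ) (f : IntervalFun) :
    pairing (sineOperator z f) f = ∫ w in (0 : ℝ)..z, spectralDensity f w := by
  simp only [pairing_sineOperator, spectralDensity, sq]

/-- The Fourier transform of a function on `[-1, 1]`, at complex frequencies. -/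
noncomputable def fourierLaplace (f : IntervalFun) (w : ℂ) : ℂ :=
  ∫ x : 𝕁, (f x : ℂ) * Complex.exp (Complex.I * w * Real.pi * x)

theorem fourierLaplace_ofReal (f : IntervalFun) (w : ℝ) :
    fourierLaplace f w = (pairing (cosCurve w) f : ℂ) + Complex.I * pairing (sinCurve w) f := by
  have h1 : Integrable fun x : 𝕁 => ((cosCurve w x * f x : ℝ) : ℂ) :=
    (integrable (cosCurve w * f)).ofReal
  have h2 : Integrable fun x : 𝕁 => ((sinCurve w x * f x : ℝ) : ℂ) :=
    (integrable (sinCurve w * f)).ofReal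
  rw [pairing_apply, pairing_apply, ← integral_complex_ofReal, ← integral_complex_ofReal,
    ← integral_const_mul, ← integral_add h1 (h2.const_mul _), fourierLaplace]
  congr 1 with x
  rw [show Complex.I * w * Real.pi * x = ((w * Real.pi * x : ℝ) : ℂ) * Complex.I by
    push_cast; ring, Complex.exp_mul_I]
  simp only [cosCurve_apply, sinCurve_apply]
  push_cast
  ring

theorem normSq_fourierLaplace (f : IntervalFun) (w : ℝ) :
    ‖fourierLaplace f w‖ ^ 2 = spectralDensity f w := by
  rw [fourierLaplace_ofReal, ← Complex.normSq_eq_norm_sq, Complex.normSq_apply, spectralDensity]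
  simp
  ring

/-- Being entire is what makes the identity theorem available for frequencies beyond `z`. -/
theorem differentiable_fourierLaplace (f : IntervalFun) : Differentiable ℂ (fourierLaplace f) := by
  intro w
  have hf : Continuous fun x : 𝕁 => f x := map_continuous f
  have hint : ∀ g : 𝕁 → ℂ, Continuous g → Integrable g := fun g hg =>
    hg.integrable_of_hasCompactSupport (HasCompactSupport.of_compactSpace _)
  refine (hasDerivAt_integral_of_dominated_loc_of_deriv_le
    (F := fun (w : ℂ) (x : 𝕁) => (f x : ℂ) * Complex.exp (Complex.I * w * Real.pi * x))
    (F' := fun (w : ℂ) (x : 𝕁) => (f x : ℂ) *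
      (Complex.exp (Complex.I * w * Real.pi * x) * (Complex.I * Real.pi * x)))
    -- On the unit ball around `w`, with `|x| ≤ 1`, the exponential is at most `e^{(‖w‖+1)π}`; the
    -- last `π` bounds the factor `iπx`.
    (bound := fun _ => ‖f‖ * (Real.exp ((‖w‖ + 1) * Real.pi) * Real.pi))
    (Metric.ball_mem_nhds w one_pos) (Eventually.of_forall fun w => ?_) ?_ ?_ ?_ ?_ ?_).2.differentiableAt
  · exact (hint _ (by fun_prop)).aestronglyMeasurable
  · exact hint _ (by fun_prop)
  · exact (hint _ (by fun_prop)).aestronglyMeasurable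
  · refine Eventually.of_forall fun x v hv => ?_
    have hx : |(x : ℝ)| ≤ 1 := abs_le.2 x.2
    have hv' : ‖v‖ ≤ ‖w‖ + 1 := by
      have := norm_sub_norm_le v w
      rw [mem_ball_iff_norm] at hv
      linarith
    rw [norm_mul, norm_mul, Complex.norm_exp]
    have hpi := Real.pi_pos
    gcongr
    · rw [Complex.norm_real]
      exact f.abs_apply_le x
    · refine (Complex.re_le_norm _).trans ?_
      simp only [norm_mul, Complex.norm_I, Complex.norm_real, Real.norm_eq_abs, abs_of_pos hpi,
        one_mul]
      calc ‖v‖ * Real.pi * |(x : ℝ)| ≤ ‖v‖ * Real.pi * 1 := by gcongr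
        _ ≤ _ := by rw [mul_one]; gcongr
    · simp only [norm_mul, Complex.norm_I, Complex.norm_real, Real.norm_eq_abs, abs_of_pos hpi,
        one_mul]
      exact mul_le_of_le_one_right hpi.le hx
  · exact integrable_const _
  · refine Eventually.of_forall fun x v _ => ?_
    have h1 : HasDerivAt (fun w : ℂ => Complex.I * w * Real.pi * x)
        (Complex.I * Real.pi * x) v := by
      have := (((hasDerivAt_id v).const_mul Complex.I).mul_const (Real.pi : ℂ)).mul_const
        ((x : ℝ) : ℂ)
      simpa using this
    exact h1.cexp.const_mul _

/-- The normalized exponential `e^{iπ(θ+n)x} / √2` in `L²(-1, 1)`. -/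
noncomputable def shiftedExp (θ : ℝ) (n : ℕ) : C(𝕁, ℂ) :=
  ⟨fun x => (Real.sqrt 2 : ℂ)⁻¹ * Complex.exp (Complex.I * ((θ + n : ℝ) : ℂ) * Real.pi * x),
    by fun_prop⟩

theorem integral_exp_int {m : ℤ} (hm : m ≠ 0) :
    ∫ x : 𝕁, Complex.exp (Complex.I * m * Real.pi * x) = 0 := by
  have hpi := Real.pi_ne_zero
  have hc : Complex.I * m * Real.pi ≠ 0 := by
    simp [hm]
  rw [integral_interval_eq (fun x : ℝ => Complex.exp (Complex.I * m * Real.pi * x)),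
    integral_exp_mul_complex hc, div_eq_zero_iff]
  left
  rw [sub_eq_zero, Complex.exp_eq_exp_iff_exists_int]
  exact ⟨m, by push_cast; ring⟩

theorem orthonormal_shiftedExp (θ : ℝ) : Orthonormal ℂ fun n =>
    ContinuousMap.toLp (E := ℂ) 2 (volume : Measure 𝕁) ℂ (shiftedExp θ n) := by
  rw [orthonormal_iff_ite]
  intro m n
  have h2 : (Real.sqrt 2 : ℂ)⁻¹ * (Real.sqrt 2 : ℂ)⁻¹ = 1 / 2 := by
    rw [← mul_inv, ← Complex.ofReal_mul, Real.mul_self_sqrt (by norm_num)]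
    norm_num
  have key : ∀ x : 𝕁, shiftedExp θ n x * (starRingEnd ℂ) (shiftedExp θ m x) =
      1 / 2 * Complex.exp (Complex.I * ((n - m : ℤ) : ℂ) * Real.pi * x) := by
    intro x
    simp only [shiftedExp, ContinuousMap.coe_mk, map_mul, map_inv₀, Complex.conj_ofReal,
      ← Complex.exp_conj, Complex.conj_I]
    rw [mul_mul_mul_comm, h2, ← Complex.exp_add]
    congr 2
    push_cast
    ring
  rw [ContinuousMap.inner_toLp]
  simp only [key]
  rw [integral_const_mul]
  split_ifs with h
  · subst h
    rw [integral_interval_eq (fun x : ℝ => Complex.exp (Complex.I * ((m - m : ℤ) : ℂ) * Real.pi * x))]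
    norm_num
  · rw [integral_exp_int (by omega), mul_zero]

/-- Bessel's inequality for the exponentials `e^{iπ(θ+n)x}`. -/
theorem sum_spectralDensity_le (f : IntervalFun) (θ : ℝ) (m : ℕ) :
    ∑ n ∈ Finset.range m, spectralDensity f (θ + n) ≤ 2 * pairing f f := by
  let F : C(𝕁, ℂ) := ⟨fun x => (f x : ℂ), by
    have : Continuous fun x : 𝕁 => f x := map_continuous f
    fun_prop⟩
  have hB := (orthonormal_shiftedExp θ).sum_inner_products_le (s := Finset.range m)
    (x := ContinuousMap.toLp (E := ℂ) 2 (volume : Measure 𝕁) ℂ F)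
  have hF : ‖ContinuousMap.toLp (E := ℂ) 2 (volume : Measure 𝕁) ℂ F‖ ^ 2 = pairing f f := by
    have h := inner_self_eq_norm_sq_to_K (𝕜 := ℂ)
      (ContinuousMap.toLp (E := ℂ) 2 (volume : Measure 𝕁) ℂ F)
    rw [ContinuousMap.inner_toLp] at h
    have h' : (∫ x : 𝕁, F x * (starRingEnd ℂ) (F x)) = ((pairing f f : ℝ) : ℂ) := by
      rw [pairing_apply, ← integral_complex_ofReal]
      simp [F]
    rw [h'] at h
    exact Complex.ofReal_injective ((Complex.ofReal_pow _ _).trans h.symm)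
  have hterm : ∀ n : ℕ, ‖inner ℂ (ContinuousMap.toLp (E := ℂ) 2 (volume : Measure 𝕁) ℂ
      (shiftedExp θ n)) (ContinuousMap.toLp (E := ℂ) 2 (volume : Measure 𝕁) ℂ F)‖ ^ 2 =
      1 / 2 * spectralDensity f (θ + n) := by
    intro n
    rw [ContinuousMap.inner_toLp]
    have h1 : ∀ x : 𝕁, F x * (starRingEnd ℂ) (shiftedExp θ n x) = (Real.sqrt 2 : ℂ)⁻¹ *
        ((f x : ℂ) * Complex.exp (Complex.I * ((-(θ + n) : ℝ) : ℂ) * Real.pi * x)) := by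
      intro x
      simp only [F, shiftedExp, ContinuousMap.coe_mk, map_mul, map_inv₀, Complex.conj_ofReal,
        ← Complex.exp_conj, Complex.conj_I]
      rw [mul_left_comm]
      congr 3
      push_cast
      ring
    simp only [h1]
    rw [integral_const_mul, norm_mul, mul_pow]
    -- Conjugation in the inner product puts the frequency at `-(θ + n)`; the density is even.
    change _ * ‖fourierLaplace f ((-(θ + n) : ℝ) : ℂ)‖ ^ 2 = _
    rw [normSq_fourierLaplace, spectralDensity_neg, norm_inv, Complex.norm_real, inv_pow,
      Real.norm_eq_abs, sq_abs, Real.sq_sqrt (by norm_num)]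
    norm_num
  rw [hF] at hB
  simp only [hterm] at hB
  rw [← Finset.mul_sum] at hB
  linarith

/-- Half of Plancherel's inequality: `[-N, N]` is cut into `2N` unit intervals, all translated onto
the first, where Bessel's inequality bounds the sum by `2 ∫ f²` for every shift `θ`. Evenness
removes the factor `2`. -/
theorem integral_spectralDensity_le (f : IntervalFun) (N : ℕ) :
    ∫ w in (0 : ℝ)..N, spectralDensity f w ≤ pairing f f := by
  have hi : ∀ a b : ℝ, IntervalIntegrable (spectralDensity f) volume a b := fun a b =>
    (continuous_spectralDensity f).intervalIntegrable a b
  have h1 : ∫ w in (-N : ℝ)..N, spectralDensity f w ≤ 2 * pairing f f := by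
    have hadj := intervalIntegral.sum_integral_adjacent_intervals (f := spectralDensity f)
      (μ := volume) (a := fun k : ℕ => (-N : ℝ) + k) (n := 2 * N) (fun k _ => hi _ _)
    have e : ((-N : ℝ) + ((2 * N : ℕ) : ℝ)) = N := by push_cast; ring
    simp only [Nat.cast_zero, add_zero] at hadj
    rw [e] at hadj
    rw [← hadj]
    have hsh : ∀ k : ℕ, ∫ w in (-N + k : ℝ)..(-N + (k + 1 : ℕ) : ℝ), spectralDensity f w =
        ∫ θ in (-N : ℝ)..(-N + 1 : ℝ), spectralDensity f (θ + k) := by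
      intro k
      rw [intervalIntegral.integral_comp_add_right]
      congr 1
      push_cast
      ring
    have hc : ∀ k : ℕ, Continuous fun θ : ℝ => spectralDensity f (θ + k) := fun k =>
      (continuous_spectralDensity f).comp (continuous_id.add continuous_const)
    rw [Finset.sum_congr rfl fun k _ => hsh k,
      ← intervalIntegral.integral_finsetSum fun k _ => (hc k).intervalIntegrable _ _]
    calc _ ≤ ∫ θ in (-N : ℝ)..(-N + 1 : ℝ), 2 * pairing f f :=
          intervalIntegral.integral_mono_on (by linarith)
            ((continuous_finsetSum _ fun k _ => hc k).intervalIntegrable _ _)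
            (continuous_const.intervalIntegrable _ _)
            fun θ _ => sum_spectralDensity_le f θ (2 * N)
      _ = _ := by simp
  have h2 : ∫ w in (-N : ℝ)..0, spectralDensity f w = ∫ w in (0 : ℝ)..N, spectralDensity f w := by
    have := intervalIntegral.integral_comp_neg (a := 0) (b := (N : ℝ)) (spectralDensity f)
    simp only [spectralDensity_neg, neg_zero] at this
    exact this.symm
  rw [← intervalIntegral.integral_add_adjacent_intervals (hi (-N) 0) (hi 0 N), h2] at h1
  linarith

/-- For a fixed function the density on `[0, z]` already accounts for all of `∫ f²`, so the
Plancherel bound leaves nothing beyond `z`; an entire function vanishing on a half-line is zero. -/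
theorem eq_zero_of_sineOperator_apply_eq {z : ℝ} {f : IntervalFun} (h : sineOperator z f = f) :
    f = 0 := by
  have hi : ∀ a b : ℝ, IntervalIntegrable (spectralDensity f) volume a b := fun a b =>
    (continuous_spectralDensity f).intervalIntegrable a b
  have hE : pairing f f = ∫ w in (0 : ℝ)..z, spectralDensity f w := by
    rw [← pairing_sineOperator_self, h]
  have hzero : ∀ w, z < w → spectralDensity f w = 0 := by
    intro w hw
    by_contra hne
    obtain ⟨N, hN⟩ := exists_nat_gt w
    have hpos : 0 < ∫ w in z..N, spectralDensity f w :=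
      intervalIntegral.integral_pos (hw.trans hN) (continuous_spectralDensity f).continuousOn
        (fun y _ => spectralDensity_nonneg f y)
        ⟨w, ⟨hw.le, hN.le⟩, (spectralDensity_nonneg f w).lt_of_ne' hne⟩
    have := integral_spectralDensity_le f N
    rw [← intervalIntegral.integral_add_adjacent_intervals (hi 0 z) (hi z N), ← hE] at this
    linarith
  have hG : ∀ w : ℝ, z < w → fourierLaplace f w = 0 := fun w hw => by
    have := normSq_fourierLaplace f w
    rw [hzero w hw] at this
    simpa using this
  have hA : AnalyticOnNhd ℂ (fourierLaplace f) univ :=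
    (differentiable_fourierLaplace f).differentiableOn.analyticOnNhd isOpen_univ
  -- The real zeros beyond `z` accumulate at `z + 1`.
  have hfreq : ∃ᶠ w in 𝓝[≠] ((z + 1 : ℝ) : ℂ), fourierLaplace f w = 0 := by
    have ht : Tendsto (fun x : ℝ => (x : ℂ)) (𝓝[≠] (z + 1)) (𝓝[≠] ((z + 1 : ℝ) : ℂ)) := by
      refine tendsto_nhdsWithin_of_tendsto_nhds_of_eventually_within _
        (Complex.continuous_ofReal.continuousAt.tendsto.mono_left nhdsWithin_le_nhds) ?_
      filter_upwards [self_mem_nhdsWithin] with x hx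
      simpa only [mem_compl_iff, mem_singleton_iff, Complex.ofReal_inj] using hx
    refine ht.frequently (Eventually.frequently ?_)
    refine nhdsWithin_le_nhds ?_
    filter_upwards [Ioi_mem_nhds (show z < z + 1 by linarith)] with x hx using hG x hx
  have hall : fourierLaplace f = 0 := by
    funext w
    exact hA.eqOn_zero_of_preconnected_of_frequently_eq_zero isPreconnected_univ (mem_univ _)
      hfreq (mem_univ w)
  have hd : spectralDensity f = 0 := by
    funext w
    rw [← normSq_fourierLaplace, hall]
    simp
  exact eq_zero_of_pairing_self (by rw [hE, hd]; simp)

theorem isUnit_one_sub_sineOperator (z : ℝ) : IsUnit (1 - sineOperator z) := by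
  rcases (isCompactOperator_sineOperator z).hasEigenvalue_or_mem_resolventSet
    (one_ne_zero (α := ℝ)) with h | h
  · obtain ⟨f, hf, hne⟩ := h.exists_hasEigenvector
    exact absurd (eq_zero_of_sineOperator_apply_eq (by simpa using Module.End.mem_eigenspace_iff.1 hf)) hne
  · simpa [spectrum.mem_resolventSet_iff] using h

/-! ### The resolvent kernel on `[-1, 1]` -/

/-- The section `x ↦ T(x, y)` of the resolvent kernel `T` of `sineOperator z`. -/
noncomputable def resolventSection (z : ℝ) (y : 𝕁) : IntervalFun :=
  Ring.inverse (1 - sineOperator z) (kernelSection z y)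

theorem one_sub_inverse_apply (z : ℝ) (f : IntervalFun) :
    Ring.inverse (1 - sineOperator z) f = f + sineOperator z (Ring.inverse (1 - sineOperator z) f) := by
  have h := congrArg (fun A : IntervalFun →L[ℝ] IntervalFun => A f)
    (Ring.mul_inverse_cancel _ (isUnit_one_sub_sineOperator z))
  simp only [mul_apply_eq_comp, sub_apply, one_apply_eq_self] at h
  exact sub_eq_iff_eq_add.1 h

theorem pairing_inverse_comm (z : ℝ) (f g : IntervalFun) :
    pairing (Ring.inverse (1 - sineOperator z) f) g =
      pairing f (Ring.inverse (1 - sineOperator z) g) := by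
  have hf := one_sub_inverse_apply z f
  have hg := one_sub_inverse_apply z g
  set F := Ring.inverse (1 - sineOperator z) f
  set G := Ring.inverse (1 - sineOperator z) g
  have h1 : f = F - sineOperator z F := eq_sub_of_add_eq hf.symm
  have h2 : g = G - sineOperator z G := eq_sub_of_add_eq hg.symm
  rw [h1, h2]
  simp [pairing_sineOperator_comm]

/-- Self-adjointness moves the inverse from `f` to the kernel section, so `resolventSection` is the
kernel of `(1 - A)⁻¹ - 1`. -/
theorem inverse_apply_apply (z : ℝ) (f : IntervalFun) (y : 𝕁) :
    Ring.inverse (1 - sineOperator z) f y = f y + pairing f (resolventSection z y) := by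
  conv_lhs => rw [one_sub_inverse_apply]
  rw [IntervalFun.add_apply, sineOperator_apply_apply, ← pairing_inverse_comm, pairing_comm, resolventSection]

theorem resolventSection_apply (z : ℝ) (x y : 𝕁) :
    resolventSection z y x =
      sineKernel z y x + pairing (kernelSection z x) (resolventSection z y) := by
  conv_lhs => rw [resolventSection, one_sub_inverse_apply]
  rw [IntervalFun.add_apply, sineOperator_apply_apply, kernelSection_apply]
  rfl

theorem sineKernel_comm (z x y : ℝ) : sineKernel z x y = sineKernel z y x := by
  rw [sineKernel, sineKernel, ← Real.sinc_neg]
  ring_nf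

theorem resolventSection_comm (z : ℝ) (x y : 𝕁) :
    resolventSection z y x = resolventSection z x y := by
  rw [resolventSection_apply, resolventSection_apply, sineKernel_comm]
  congr 1
  rw [resolventSection, ← pairing_inverse_comm, pairing_comm]
  rfl

theorem continuous_resolventSection (z : ℝ) : Continuous (resolventSection z) :=
  (Ring.inverse (1 - sineOperator z)).continuous.comp (continuous_kernelSection z)

/-- With `R = (1 - A)⁻¹` and `T_y = R k_y`, the derivative is `R A' T_y + R k_y'`. Since `A' = c ⊗ c
+ s ⊗ s` and `k_y' = c(y) c + s(y) s`, its value at `y` is `(⟨c, T_y⟩ + c(y)) (Rc)(y)` plus the same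
for `s`. By `inverse_apply_apply` the two factors agree, hence the squares. -/
theorem hasDerivAt_resolventSection_diag (z : ℝ) (y : 𝕁) :
    HasDerivAt (fun z => resolventSection z y y)
      ((cosCurve z y + pairing (cosCurve z) (resolventSection z y)) ^ 2 +
        (sinCurve z y + pairing (sinCurve z) (resolventSection z y)) ^ 2) z := by
  obtain ⟨u, hu⟩ := isUnit_one_sub_sineOperator z
  have hA : HasDerivAt (fun z => Ring.inverse (1 - sineOperator z))
      (Ring.inverse (1 - sineOperator z) * (rankOne (cosCurve z) + rankOne (sinCurve z)) *
        Ring.inverse (1 - sineOperator z)) z := by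
    have h1 := (hasDerivAt_sineOperator z).const_sub 1
    have h2 := hasFDerivAt_ringInverse (𝕜 := ℝ) u
    rw [hu] at h2
    have h3 := h2.comp_hasDerivAt z h1
    refine h3.congr_deriv ?_
    simp only [← Ring.inverse_unit, hu, neg_apply, ContinuousLinearMap.mulLeftRight_apply]
    have hneg : ∀ {R : Type} [Ring R] (a b : R), -(a * -b * a) = a * b * a := by
      intros
      simp
    exact hneg _ _
  have hT := hA.clm_apply (hasDerivAt_kernelSection z y)
  have hE := (eval y).hasFDerivAt.comp_hasDerivAt z hT
  refine hE.congr_deriv ?_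
  have hg : Ring.inverse (1 - sineOperator z) (kernelSection z y) = resolventSection z y := rfl
  have hc := inverse_apply_apply z (cosCurve z) y
  have hs := inverse_apply_apply z (sinCurve z) y
  simp only [mul_apply_eq_comp, add_apply, hg, rankOne_apply,
    map_add, map_smul, eval_apply, smul_eq_mul, hc, hs]
  ring

theorem resolventSection_zero (y : 𝕁) : resolventSection 0 y = 0 := by
  have h : kernelSection 0 y = 0 := by
    ext x
    simp [kernelSection_apply, sineKernel]
  rw [resolventSection, h, map_zero]

/-! ### Fredholm's series -/

/-- The cube `[a, b]ⁿ`. -/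
def cube (n : ℕ) (a b : ℝ) : Set (Fin n → ℝ) := (univ : Set (Fin n)).pi fun _ => Icc a b

theorem isCompact_cube (n : ℕ) (a b : ℝ) : IsCompact (cube n a b) :=
  isCompact_univ_pi fun _ => isCompact_Icc

theorem volume_real_cube (n : ℕ) {a b : ℝ} (h : a ≤ b) :
    (volume : Measure (Fin n → ℝ)).real (cube n a b) = (b - a) ^ n := by
  rw [cube, pi_univ_Icc, Measure.real, Real.volume_Icc_pi_toReal (fun _ => h)]
  simp

theorem integrableOn_cube {n : ℕ} {a b : ℝ} {g : (Fin n → ℝ) → ℝ} (hg : Continuous g) :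
    IntegrableOn g (cube n a b) :=
  hg.continuousOn.integrableOn_compact (isCompact_cube n a b)

theorem setIntegral_cube_succAbove {n : ℕ} {a b : ℝ} (hab : a ≤ b) (j : Fin (n + 1))
    {g : ℝ → (Fin n → ℝ) → ℝ} (hg : Continuous (Function.uncurry g)) :
    ∫ v in cube (n + 1) a b, g (v j) (fun i => v (j.succAbove i)) =
      ∫ s in a..b, ∫ v in cube n a b, g s v := by
  have hpre : cube (n + 1) a b =
      MeasurableEquiv.piFinSuccAbove (fun _ : Fin (n + 1) => ℝ) j ⁻¹' (Icc a b ×ˢ cube n a b) := by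
    ext v
    simp only [cube, mem_univ_pi, mem_preimage, mem_prod, j.forall_iff_succAbove]
    rfl
  have hprod := setIntegral_prod (μ := volume) (ν := volume) (s := Icc a b) (Function.uncurry g)
    (hg.continuousOn.integrableOn_compact (isCompact_Icc.prod (isCompact_cube n a b)))
  rw [← Measure.volume_eq_prod,
    ← (volume_preserving_piFinSuccAbove (fun _ : Fin (n + 1) => ℝ) j).setIntegral_preimage_emb
      (MeasurableEquiv.measurableEmbedding _), ← hpre] at hprod
  rw [intervalIntegral.integral_of_le hab, ← integral_Icc_eq_integral_Ioc]
  exact hprod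

/-- The determinant of the matrix `k (vᵢ, wⱼ)`. -/
noncomputable def kernelDet (k : ℝ → ℝ → ℝ) {n : ℕ} (v w : Fin n → ℝ) : ℝ :=
  (Matrix.of fun i j : Fin n => k (v i) (w j)).det

theorem continuous_kernelDet {k : ℝ → ℝ → ℝ} (hk : Continuous (Function.uncurry k)) {n : ℕ}
    {Y : Type*} [TopologicalSpace Y] {v w : Y → Fin n → ℝ} (hv : Continuous v)
    (hw : Continuous w) : Continuous fun y => kernelDet k (v y) (w y) := by
  refine Continuous.matrix_det (continuous_matrix fun i j => ?_)
  exact hk.comp (((continuous_apply i).comp hv).prodMk ((continuous_apply j).comp hw))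

theorem continuous_cons {Y : Type*} [TopologicalSpace Y] {n : ℕ} {x : Y → ℝ} {v : Y → Fin n → ℝ}
    (hx : Continuous x) (hv : Continuous v) :
    Continuous fun y => (Fin.cons (x y) (v y) : Fin (n + 1) → ℝ) := by
  refine continuous_pi fun i => ?_
  refine Fin.cases ?_ (fun i => ?_) i
  · simpa using hx
  · simpa [Function.comp_def] using (continuous_apply i).comp hv

theorem kernelDet_comp_perm_left (k : ℝ → ℝ → ℝ) {n : ℕ} (σ : Equiv.Perm (Fin n))
    (v w : Fin n → ℝ) :
    kernelDet k (v ∘ σ) w = (Equiv.Perm.sign σ : ℤ) * kernelDet k v w :=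
  Matrix.det_permute σ (Matrix.of fun i j : Fin n => k (v i) (w j))

theorem kernelDet_comp_perm (k : ℝ → ℝ → ℝ) {n : ℕ} (σ : Equiv.Perm (Fin n))
    (v w : Fin n → ℝ) : kernelDet k (v ∘ σ) (w ∘ σ) = kernelDet k v w :=
  Matrix.det_submatrix_equiv_self σ (Matrix.of fun i j : Fin n => k (v i) (w j))

theorem kernelDet_eq_cons_succAbove (k : ℝ → ℝ → ℝ) {n : ℕ} (j : Fin (n + 1))
    (v w : Fin (n + 1) → ℝ) :
    kernelDet k v w =
      (-1) ^ (j : ℕ) * kernelDet k (Fin.cons (v j) fun i => v (j.succAbove i)) w := by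
  have h : (Fin.cons (v j) fun i => v (j.succAbove i) : Fin (n + 1) → ℝ) =
      v ∘ (j.cycleRange.symm : Equiv.Perm (Fin (n + 1))) := by
    funext i
    refine Fin.cases ?_ (fun i => ?_) i
    · simp [Fin.cycleRange_symm_zero]
    · simp [Fin.cycleRange_symm_succ]
  rw [h, kernelDet_comp_perm_left, Equiv.Perm.sign_symm, Fin.sign_cycleRange, ← mul_assoc]
  push_cast
  rw [← mul_pow]
  simp

/-- Laplace expansion along the first row. Column `j + 1` carries the sign `(-1)^(j+1)`, and moving
the row of `v j` to the front of the minor costs `(-1)^j`, so every term is subtracted. -/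
theorem kernelDet_cons_cons (k : ℝ → ℝ → ℝ) {n : ℕ} (x y : ℝ) (v : Fin (n + 1) → ℝ) :
    kernelDet k (Fin.cons x v : Fin (n + 2) → ℝ) (Fin.cons y v) = k x y * kernelDet k v v -
      ∑ j : Fin (n + 1), k x (v j) * kernelDet k (Fin.cons (v j) fun i => v (j.succAbove i))
        (Fin.cons y fun i => v (j.succAbove i)) := by
  rw [kernelDet, Matrix.det_succ_row_zero, Fin.sum_univ_succ, sub_eq_add_neg,
    ← Finset.sum_neg_distrib]
  congr 1
  · simp only [Fin.val_zero, pow_zero, one_mul, Matrix.of_apply, Fin.cons_zero]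
    rfl
  · refine Finset.sum_congr rfl fun j _ => ?_
    have h : ((Matrix.of fun i j : Fin (n + 2) => k ((Fin.cons x v : Fin (n + 2) → ℝ) i)
        ((Fin.cons y v : Fin (n + 2) → ℝ) j)).submatrix Fin.succ j.succ.succAbove).det =
        kernelDet k v (Fin.cons y fun i => v (j.succAbove i)) := by
      rw [kernelDet]
      congr 1
      ext p q
      refine Fin.cases ?_ (fun q => ?_) q
      · simp
      · simp [Fin.succ_succAbove_succ]
    rw [h, kernelDet_eq_cons_succAbove k j]
    simp only [Matrix.of_apply, Fin.cons_zero, Fin.cons_succ, Fin.val_succ]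
    have hs : ((-1 : ℝ) ^ (j : ℕ)) * (-1) ^ (j : ℕ) = 1 := by
      rw [← mul_pow]
      simp
    linear_combination (-k x (v j) * kernelDet k (Fin.cons (v j) fun i => v (j.succAbove i))
        (Fin.cons y fun i => v (j.succAbove i))) * hs

/-! ### Hadamard's bound and convergence of Fredholm's series -/

/-- Hadamard's inequality. -/
theorem abs_det_le_prod_norm {n : ℕ} (M : Matrix (Fin n) (Fin n) ℝ) :
    |M.det| ≤ ∏ i, ‖WithLp.toLp 2 (M i)‖ := by
  have : Fact (Module.finrank ℝ (EuclideanSpace ℝ (Fin n)) = n) := ⟨by simp⟩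
  let e := EuclideanSpace.basisFun (Fin n) ℝ
  have h := e.toBasis.orientation.abs_volumeForm_apply_le fun i => WithLp.toLp 2 (M i)
  rw [e.toBasis.orientation.volumeForm_robust e rfl, Module.Basis.det_apply] at h
  rw [← Matrix.det_transpose]
  convert h using 3
  ext i j
  simp [e, Module.Basis.toMatrix_apply]

theorem abs_kernelDet_le {k : ℝ → ℝ → ℝ} {B : ℝ} (hB : ∀ x y, |k x y| ≤ B) {n : ℕ}
    (v w : Fin n → ℝ) : |kernelDet k v w| ≤ (B * Real.sqrt n) ^ n := by
  have hB0 : 0 ≤ B := (abs_nonneg _).trans (hB 0 0)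
  refine (abs_det_le_prod_norm _).trans ?_
  calc _ ≤ ∏ _i : Fin n, B * Real.sqrt n := by
        refine Finset.prod_le_prod (fun _ _ => norm_nonneg _) fun i _ => ?_
        rw [EuclideanSpace.norm_eq, ← Real.sqrt_sq hB0, ← Real.sqrt_mul (sq_nonneg B)]
        refine Real.sqrt_le_sqrt ?_
        calc _ ≤ ∑ _j : Fin n, B ^ 2 := by
              refine Finset.sum_le_sum fun j _ => ?_
              exact pow_le_pow_left₀ (norm_nonneg _) (hB _ _) 2
          _ = _ := by simp [mul_comm]
    _ = _ := by simp

/-- Hadamard's bound for the terms of Fredholm's series. -/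
noncomputable def hadamardBound (B L : ℝ) (n : ℕ) : ℝ :=
  (n.factorial : ℝ)⁻¹ * ((B * Real.sqrt (n + 1 : ℕ)) ^ (n + 1) * L ^ n)

/-- The terms decay like `Cⁿ / √(n!)`. To avoid the square root, their squares are compared with an
exponential series and `|t| ≤ 4ⁿt² + 4⁻ⁿ` is used. -/
theorem summable_hadamardBound (B L : ℝ) : Summable (hadamardBound B L) := by
  have key : ∀ n : ℕ, hadamardBound B L n ^ 2 ≤
      Real.exp 1 * B ^ 2 * ((2 * Real.exp 1 * B ^ 2 * L ^ 2) ^ n / n.factorial) := by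
    intro n
    -- One term of the series of `e^{n+1}`.
    have h1 : ((n + 1 : ℕ) : ℝ) ^ n ≤ Real.exp 1 ^ (n + 1) * n.factorial := by
      have := Real.pow_div_factorial_le_exp ((n + 1 : ℕ) : ℝ) (by positivity) n
      rw [div_le_iff₀ (by positivity)] at this
      rwa [← Real.exp_nat_mul, mul_one]
    have h2 : ((n + 1 : ℕ) : ℝ) ≤ 2 ^ n := by exact_mod_cast Nat.lt_two_pow_self
    have h3 : Real.sqrt (n + 1 : ℕ) ^ 2 = ((n + 1 : ℕ) : ℝ) := Real.sq_sqrt (by positivity)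
    have hf : (0 : ℝ) < n.factorial := by positivity
    have e1 : hadamardBound B L n ^ 2 = (n.factorial : ℝ)⁻¹ ^ 2 * (B ^ 2 * (B ^ 2 * L ^ 2) ^ n) *
        (((n + 1 : ℕ) : ℝ) * ((n + 1 : ℕ) : ℝ) ^ n) := by
      rw [← pow_succ', ← h3, hadamardBound]
      ring
    calc _ = _ := e1
      _ ≤ (n.factorial : ℝ)⁻¹ ^ 2 * (B ^ 2 * (B ^ 2 * L ^ 2) ^ n) *
          (2 ^ n * (Real.exp 1 ^ (n + 1) * n.factorial)) := by gcongr
      _ = _ := by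
        field_simp
        ring
  have hs : Summable fun n : ℕ => Real.exp 1 * B ^ 2 *
      ((8 * Real.exp 1 * B ^ 2 * L ^ 2) ^ n / n.factorial) + (1 / 4 : ℝ) ^ n :=
    ((Real.summable_pow_div_factorial _).mul_left _).add
      (summable_geometric_of_lt_one (by norm_num) (by norm_num))
  refine Summable.of_norm_bounded hs fun n => ?_
  have h := key n
  have e : Real.exp 1 * B ^ 2 * ((8 * Real.exp 1 * B ^ 2 * L ^ 2) ^ n / n.factorial) =
      4 ^ n * (Real.exp 1 * B ^ 2 * ((2 * Real.exp 1 * B ^ 2 * L ^ 2) ^ n / n.factorial)) := by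
    rw [show 8 * Real.exp 1 * B ^ 2 * L ^ 2 = 4 * (2 * Real.exp 1 * B ^ 2 * L ^ 2) by ring, mul_pow]
    ring
  rw [e, Real.norm_eq_abs]
  have h4 : (0 : ℝ) < 2 ^ n := by positivity
  have h5 : (4 : ℝ) ^ n = 2 ^ n * 2 ^ n := by rw [← mul_pow]; norm_num
  have h6 : (1 / 4 : ℝ) ^ n = (2 ^ n)⁻¹ * (2 ^ n)⁻¹ := by
    rw [one_div, inv_pow, h5, mul_inv]
  have h7 : (2 : ℝ) ^ n * (2 ^ n)⁻¹ = 1 := mul_inv_cancel₀ h4.ne'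
  have h8 : 4 ^ n * hadamardBound B L n ^ 2 ≤
      4 ^ n * (Real.exp 1 * B ^ 2 * ((2 * Real.exp 1 * B ^ 2 * L ^ 2) ^ n / n.factorial)) := by
    gcongr
  rw [h6]
  rw [h5] at h8 ⊢
  set t := hadamardBound B L n
  -- Expanding this square gives `2|t| ≤ 4ⁿt² + 4⁻ⁿ`.
  have h9 := sq_nonneg (2 ^ n * |t| - (2 ^ n)⁻¹)
  have h10 : |t| ^ 2 = t ^ 2 := sq_abs t
  nlinarith [abs_nonneg t, h9, h10, h8, h7, mul_self_nonneg ((2 : ℝ) ^ n)⁻¹]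

/-! ### Fredholm's determinant and first minor -/

variable (k : ℝ → ℝ → ℝ) (a b : ℝ)

/-- The term of Fredholm's series of the determinant `det (1 - K)`. -/
noncomputable def detTerm (n : ℕ) : ℝ :=
  (-1) ^ n / (n.factorial : ℝ) * ∫ v in cube n a b, kernelDet k v v

/-- The term of Fredholm's series of the first minor. -/
noncomputable def minorTerm (n : ℕ) (x y : ℝ) : ℝ :=
  (-1) ^ n / (n.factorial : ℝ) * ∫ v in cube n a b, kernelDet k (Fin.cons x v : Fin (n + 1) → ℝ)
    (Fin.cons y v)

/-- Fredholm's first minor of `1 - K`. -/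
noncomputable def fredholmMinor (x y : ℝ) : ℝ := ∑' n, minorTerm k a b n x y

variable {k a b}

/-- The row expansion is integrated over the cube. By Fubini its `n + 1` subtracted terms have equal
integrals, and the count `n + 1` turns `1/(n+1)!` into `1/n!`. -/
theorem minorTerm_succ (hk : Continuous (Function.uncurry k)) (hab : a ≤ b) (n : ℕ) (x y : ℝ) :
    minorTerm k a b (n + 1) x y =
      k x y * detTerm k a b (n + 1) + ∫ s in a..b, k x s * minorTerm k a b n s y := by
  have hc : ∀ j : Fin (n + 1), Continuous fun v : Fin (n + 1) → ℝ => k x (v j) *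
      kernelDet k (Fin.cons (v j) fun i => v (j.succAbove i) : Fin (n + 1) → ℝ)
        (Fin.cons y fun i => v (j.succAbove i)) := fun j =>
    (hk.comp (continuous_const.prodMk (continuous_apply j))).mul
      (continuous_kernelDet hk (continuous_cons (by fun_prop) (by fun_prop))
        (continuous_cons (by fun_prop) (by fun_prop)))
  have hd : Continuous fun v : Fin (n + 1) → ℝ => kernelDet k v v :=
    continuous_kernelDet hk continuous_id continuous_id
  have hj : ∀ j : Fin (n + 1), ∫ v in cube (n + 1) a b, k x (v j) *
      kernelDet k (Fin.cons (v j) fun i => v (j.succAbove i) : Fin (n + 1) → ℝ)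
        (Fin.cons y fun i => v (j.succAbove i)) =
      ∫ s in a..b, k x s * ∫ v in cube n a b, kernelDet k (Fin.cons s v : Fin (n + 1) → ℝ)
        (Fin.cons y v) := by
    intro j
    rw [setIntegral_cube_succAbove hab j (g := fun s v => k x s *
      kernelDet k (Fin.cons s v : Fin (n + 1) → ℝ) (Fin.cons y v))]
    · simp only [integral_const_mul]
    · exact (hk.comp (continuous_const.prodMk continuous_fst)).mul
        (continuous_kernelDet hk (continuous_cons continuous_fst continuous_snd)
          (continuous_cons continuous_const continuous_snd))
  have hm : ∫ v in cube (n + 1) a b, kernelDet k (Fin.cons x v : Fin (n + 2) → ℝ) (Fin.cons y v) =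
      k x y * (∫ v in cube (n + 1) a b, kernelDet k v v) - (n + 1) *
        ∫ s in a..b, k x s * ∫ v in cube n a b, kernelDet k (Fin.cons s v : Fin (n + 1) → ℝ)
          (Fin.cons y v) := by
    simp only [kernelDet_cons_cons]
    rw [integral_sub ((integrableOn_cube hd).const_mul _)
      (integrable_finsetSum _ fun j _ => integrableOn_cube (hc j)), integral_const_mul,
      integral_finsetSum _ fun j _ => integrableOn_cube (hc j), Finset.sum_congr rfl fun j _ => hj j]
    simp
  have hi : ∫ s in a..b, k x s * minorTerm k a b n s y = (-1) ^ n / (n.factorial : ℝ) *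
      ∫ s in a..b, k x s * ∫ v in cube n a b, kernelDet k (Fin.cons s v : Fin (n + 1) → ℝ)
        (Fin.cons y v) := by
    rw [← intervalIntegral.integral_const_mul]
    congr 1 with s
    rw [minorTerm]
    ring
  have hn : ((n : ℝ) + 1) ≠ 0 := by positivity
  have hf : (n.factorial : ℝ) ≠ 0 := by positivity
  rw [hi, minorTerm, hm, detTerm, Nat.factorial_succ]
  push_cast
  field_simp
  ring

theorem fredholmDet_one : fredholmDet a b k 1 = ∑' n, detTerm k a b n := rfl

theorem continuous_minorTerm (hk : Continuous (Function.uncurry k)) (n : ℕ) (y : ℝ) :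
    Continuous fun x => minorTerm k a b n x y := by
  refine continuous_const.mul (continuous_parametric_integral_of_continuous
    (f := fun x v => kernelDet k (Fin.cons x v : Fin (n + 1) → ℝ) (Fin.cons y v)) ?_
    (isCompact_cube n a b))
  exact continuous_kernelDet hk (continuous_cons continuous_fst continuous_snd)
    (continuous_cons continuous_const continuous_snd)

theorem minorTerm_zero (x y : ℝ) : minorTerm k a b 0 x y = k x y := by
  have h : (volume : Measure (Fin 0 → ℝ)).real (cube 0 a b) = 1 := by
    rw [cube, Subsingleton.elim (univ : Set (Fin 0)) ∅, empty_pi]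
    simp [Measure.real, volume_pi]
  simp [minorTerm, kernelDet, h]

theorem detTerm_zero : detTerm k a b 0 = 1 := by
  have h : (volume : Measure (Fin 0 → ℝ)).real (cube 0 a b) = 1 := by
    rw [cube, Subsingleton.elim (univ : Set (Fin 0)) ∅, empty_pi]
    simp [Measure.real, volume_pi]
  simp [detTerm, kernelDet, h]

theorem norm_minorTerm_le {B : ℝ} (hB : ∀ x y, |k x y| ≤ B) (hab : a ≤ b) (n : ℕ) (x y : ℝ) :
    ‖minorTerm k a b n x y‖ ≤ hadamardBound B (b - a) n := by
  have h := norm_setIntegral_le_of_norm_le_const (μ := volume)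
    (isCompact_cube n a b).measure_lt_top
    (f := fun v => kernelDet k (Fin.cons x v : Fin (n + 1) → ℝ) (Fin.cons y v))
    (fun v _ => abs_kernelDet_le hB _ _)
  rw [volume_real_cube n hab] at h
  rw [minorTerm, norm_mul, hadamardBound, norm_div, norm_pow]
  simp only [norm_neg, norm_one, one_pow, RCLike.norm_natCast, one_div]
  gcongr

theorem summable_detTerm {B : ℝ} (hB : ∀ x y, |k x y| ≤ B) (hab : a ≤ b) :
    Summable (detTerm k a b) := by
  have hB0 : 0 ≤ B := (abs_nonneg _).trans (hB 0 0)
  have hab' : 0 ≤ b - a := sub_nonneg.2 hab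
  -- `hadamardBound` at `n` bounds determinants of size `n + 1`; the extra side of the cube gives
  -- the factor `b - a`.
  rw [← summable_nat_add_iff 1]
  refine Summable.of_norm_bounded ((summable_hadamardBound B (b - a)).mul_left (b - a)) fun n => ?_
  have h := norm_setIntegral_le_of_norm_le_const (μ := volume)
    (isCompact_cube (n + 1) a b).measure_lt_top
    (f := fun v => kernelDet k v v) (fun v _ => abs_kernelDet_le hB v v)
  rw [volume_real_cube (n + 1) hab] at h
  rw [detTerm, norm_mul, hadamardBound, norm_div, norm_pow]
  simp only [norm_neg, norm_one, one_pow, RCLike.norm_natCast, one_div]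
  calc _ ≤ (n.factorial : ℝ)⁻¹ * ((B * Real.sqrt (n + 1 : ℕ)) ^ (n + 1) * (b - a) ^ (n + 1)) := by
        gcongr
        exact Nat.le_succ n
    _ = _ := by ring

theorem continuous_fredholmMinor (hk : Continuous (Function.uncurry k)) {B : ℝ}
    (hB : ∀ x y, |k x y| ≤ B) (hab : a ≤ b) (y : ℝ) :
    Continuous fun x => fredholmMinor k a b x y :=
  continuous_tsum (fun n => continuous_minorTerm hk n y) (summable_hadamardBound B (b - a))
    fun n x => norm_minorTerm_le hB hab n x y

/-- Fredholm's equation for the first minor. -/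
theorem fredholmMinor_eq (hk : Continuous (Function.uncurry k)) {B : ℝ}
    (hB : ∀ x y, |k x y| ≤ B) (hab : a ≤ b) (x y : ℝ) :
    fredholmMinor k a b x y =
      fredholmDet a b k 1 * k x y + ∫ s in a..b, k x s * fredholmMinor k a b s y := by
  have hB0 : 0 ≤ B := (abs_nonneg _).trans (hB 0 0)
  have hkx : Continuous fun s => k x s := hk.comp (continuous_const.prodMk continuous_id)
  have hsum : ∀ s, Summable fun n => minorTerm k a b n s y := fun s =>
    Summable.of_norm_bounded (summable_hadamardBound B (b - a)) fun n =>
      norm_minorTerm_le hB hab n s y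
  have hint : HasSum (fun n => ∫ s in a..b, k x s * minorTerm k a b n s y)
      (∫ s in a..b, k x s * fredholmMinor k a b s y) := by
    refine intervalIntegral.hasSum_integral_of_dominated_convergence
      (fun n _ => B * hadamardBound B (b - a) n) (fun n => ?_) (fun n => ?_) ?_ ?_ ?_
    · exact (hkx.mul (continuous_minorTerm hk n y)).aestronglyMeasurable
    · refine Eventually.of_forall fun s _ => ?_
      rw [norm_mul]
      exact mul_le_mul (hB x s) (norm_minorTerm_le hB hab n s y) (norm_nonneg _) hB0
    · exact Eventually.of_forall fun s _ => (summable_hadamardBound B (b - a)).mul_left B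
    · exact intervalIntegrable_const
    · exact Eventually.of_forall fun s _ => ((hsum s).hasSum).mul_left _
  rw [fredholmMinor, (hsum x).tsum_eq_zero_add, minorTerm_zero, fredholmDet_one,
    (summable_detTerm hB hab).tsum_eq_zero_add, detTerm_zero]
  simp only [minorTerm_succ hk hab]
  rw [Summable.tsum_add (((summable_nat_add_iff 1).2 (summable_detTerm hB hab)).mul_left _)
    hint.summable, tsum_mul_left, hint.tsum_eq]
  ring

/-! ### Integrals of symmetric functions over cubes -/

/-- The part of the cube `[-b, b]ⁿ⁺¹` where the coordinate `j` dominates. -/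
def dominantPart (n : ℕ) (b : ℝ) (j : Fin (n + 1)) : Set (Fin (n + 1) → ℝ) :=
  {v | |v j| ≤ b ∧ ∀ i, |v (j.succAbove i)| < |v j|}

theorem dominantPart_subset_cube (n : ℕ) (b : ℝ) (j : Fin (n + 1)) :
    dominantPart n b j ⊆ cube (n + 1) (-b) b := by
  intro v hv i _
  change v i ∈ Icc (-b) b
  rw [mem_Icc, ← abs_le]
  rcases eq_or_ne i j with rfl | h
  · exact hv.1
  · obtain ⟨m, rfl⟩ := Fin.exists_succAbove_eq h
    exact (hv.2 m).le.trans hv.1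

theorem measurableSet_dominantPart (n : ℕ) (b : ℝ) (j : Fin (n + 1)) :
    MeasurableSet (dominantPart n b j) := by
  have h : dominantPart n b j =
      {v | |v j| ≤ b} ∩ ⋂ i, {v | |v (j.succAbove i)| < |v j|} := by
    ext v
    simp [dominantPart]
  rw [h]
  exact (measurableSet_le (by fun_prop) (by fun_prop)).inter
    (MeasurableSet.iInter fun i => measurableSet_lt (by fun_prop) (by fun_prop))

theorem pairwise_disjoint_dominantPart (n : ℕ) (b : ℝ) :
    Pairwise (Function.onFun Disjoint (dominantPart n b)) := by
  intro i j hij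
  refine Set.disjoint_left.2 fun v hi hj => ?_
  obtain ⟨p, hp⟩ := Fin.exists_succAbove_eq hij
  obtain ⟨q, hq⟩ := Fin.exists_succAbove_eq hij.symm
  have h1 := hi.2 q
  have h2 := hj.2 p
  rw [hq] at h1
  rw [hp] at h2
  exact lt_asymm h1 h2

theorem volume_abs_eq_abs {ι : Type*} [Fintype ι] [DecidableEq ι] {i j : ι} (hij : i ≠ j) :
    volume {v : ι → ℝ | |v i| = |v j|} = 0 := by
  have h : ∀ c : ℝ, volume {v : ι → ℝ | v i = c * v j} = 0 := by
    intro c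
    let φ : (ι → ℝ) →ₗ[ℝ] ℝ := LinearMap.proj i - c • LinearMap.proj j
    have hφ : {v : ι → ℝ | v i = c * v j} = (LinearMap.ker φ : Set (ι → ℝ)) := by
      ext v
      simp [φ, sub_eq_zero]
    rw [hφ]
    refine Measure.addHaar_submodule _ _ fun htop => ?_
    have : φ (Pi.single i 1) = 0 := LinearMap.mem_ker.1 (htop ▸ Submodule.mem_top)
    simp [φ, hij.symm] at this
  refine measure_mono_null (t := {v | v i = 1 * v j} ∪ {v | v i = -1 * v j}) ?_
    (measure_union_null (h 1) (h (-1)))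
  intro v hv
  rcases abs_eq_abs.1 hv with h | h
  · exact Or.inl (by simpa using h)
  · exact Or.inr (by simpa using h)

/-- Only points where two coordinates tie in modulus are missed, and these lie in finitely many
hyperplanes. -/
theorem iUnion_dominantPart_ae_eq (n : ℕ) (b : ℝ) :
    (⋃ j, dominantPart n b j) =ᵐ[volume] cube (n + 1) (-b) b := by
  refine (iUnion_subset (dominantPart_subset_cube n b)).eventuallyLE.antisymm ?_
  rw [ae_le_set]
  refine measure_mono_null (t := ⋃ (i) (j) (_ : i ≠ j), {v : Fin (n + 1) → ℝ | |v i| = |v j|}) ?_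
    (measure_iUnion_null fun i => measure_iUnion_null fun j => measure_iUnion_null fun hij =>
      volume_abs_eq_abs hij)
  rintro v ⟨hv, hnot⟩
  obtain ⟨j, hj⟩ := Finite.exists_max fun i => |v i|
  have hnj : v ∉ dominantPart n b j := fun h => hnot (mem_iUnion.2 ⟨j, h⟩)
  simp only [dominantPart, mem_ofPred_eq, not_and, not_forall, not_lt] at hnj
  obtain ⟨i, hi⟩ := hnj (abs_le.2 (hv j (mem_univ j)))
  simp only [mem_iUnion]
  exact ⟨j.succAbove i, j, Fin.succAbove_ne j i, (hj _).antisymm hi⟩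

theorem setIntegral_cube_neg {n : ℕ} (t : ℝ) (g : (Fin n → ℝ) → ℝ) :
    ∫ v in cube n (-t) t, g (-v) = ∫ v in cube n (-t) t, g v := by
  have hpre : cube n (-t) t = (fun v => -v) ⁻¹' cube n (-t) t := by
    ext v
    simp only [cube, mem_univ_pi, mem_preimage, Pi.neg_apply, mem_Icc, neg_le_neg_iff]
    exact forall_congr' fun i => ⟨fun h => ⟨h.2, by linarith [h.1]⟩, fun h => ⟨by linarith [h.2], h.1⟩⟩
  conv_lhs => rw [hpre]
  exact (Measure.measurePreserving_neg (volume : Measure (Fin n → ℝ))).setIntegral_preimage_emb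
    (MeasurableEquiv.neg (Fin n → ℝ)).measurableEmbedding g _

/-- Permutation symmetry moves the dominant coordinate `s` to the front; the slice over it is the
cube of half-side `|s|`. Symmetry under `v ↦ -v` makes `s` and `-s` contribute equally, whence the
factor `2`. -/
theorem setIntegral_dominantPart {n : ℕ} {F : (Fin (n + 1) → ℝ) → ℝ} (hF : Continuous F)
    (hperm : ∀ (σ : Equiv.Perm (Fin (n + 1))) v, F (v ∘ σ) = F v) (hneg : ∀ v, F (-v) = F v)
    {b : ℝ} (hb : 0 ≤ b) (j : Fin (n + 1)) :
    ∫ v in dominantPart n b j, F v =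
      2 * ∫ s in (0 : ℝ)..b, ∫ v in cube n (-s) s, F (Fin.cons (-s) v) := by
  let V : Set (ℝ × (Fin n → ℝ)) := {p | |p.1| ≤ b ∧ ∀ i, |p.2 i| < |p.1|}
  let f : ℝ × (Fin n → ℝ) → ℝ := fun p => F (Fin.cons p.1 p.2)
  have hf : Continuous f := hF.comp (continuous_cons continuous_fst continuous_snd)
  have hVm : MeasurableSet V := by
    have h : V = {p | |p.1| ≤ b} ∩ ⋂ i, {p | |p.2 i| < |p.1|} := by
      ext p
      simp [V]
    rw [h]
    exact (measurableSet_le (by fun_prop) (by fun_prop)).inter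
      (MeasurableSet.iInter fun i => measurableSet_lt (by fun_prop) (by fun_prop))
  have hVsub : V ⊆ Icc (-b) b ×ˢ cube n (-b) b := fun p hp =>
    ⟨abs_le.1 hp.1, fun i _ => abs_le.1 ((hp.2 i).le.trans hp.1)⟩
  have hVi : IntegrableOn f V := (hf.continuousOn.integrableOn_compact
    (isCompact_Icc.prod (isCompact_cube n (-b) b))).mono_set hVsub
  have hcons : ∀ v : Fin (n + 1) → ℝ, F v = F (Fin.cons (v j) fun i => v (j.succAbove i)) := by
    intro v
    rw [← hperm j.cycleRange.symm v]
    congr 1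
    funext i
    refine Fin.cases ?_ (fun i => ?_) i
    · simp [Fin.cycleRange_symm_zero]
    · simp [Fin.cycleRange_symm_succ]
  have h1 : ∫ v in dominantPart n b j, F v = ∫ p in V, f p := by
    rw [← (volume_preserving_piFinSuccAbove (fun _ : Fin (n + 1) => ℝ) j).setIntegral_preimage_emb
      (MeasurableEquiv.measurableEmbedding _)]
    exact setIntegral_congr_fun (measurableSet_dominantPart n b j) fun v _ => hcons v
  let H : ℝ → ℝ := fun t => ∫ v in cube n (-t) t, F (Fin.cons (-t) v)
  have hsign : ∀ s t : ℝ, |s| = t → ∫ v in cube n (-t) t, F (Fin.cons s v) = H t := by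
    intro s t hst
    rcases abs_choice s with h | h
    · rw [← setIntegral_cube_neg]
      have : s = t := by rw [← hst, h]
      subst this
      refine integral_congr_ae (Eventually.of_forall fun v => ?_)
      dsimp only
      rw [← hneg]
      congr 1
      funext i
      refine Fin.cases ?_ (fun i => ?_) i <;> simp
    · have : s = -t := by rw [← hst, h, neg_neg]
      rw [this]
  have hinner : ∀ s : ℝ, ∫ v, V.indicator f (s, v) = (Iic b).indicator H |s| := by
    intro s
    by_cases hs : |s| ≤ b
    · rw [indicator_of_mem (mem_Iic.2 hs), ← hsign s _ rfl]
      have hset : (fun v => V.indicator f (s, v)) =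
          ((univ : Set (Fin n)).pi fun _ => Ioo (-|s|) |s|).indicator
            fun v => F (Fin.cons s v) := by
        funext v
        by_cases hv : v ∈ (univ : Set (Fin n)).pi fun _ => Ioo (-|s|) |s|
        · rw [indicator_of_mem hv, indicator_of_mem]
          exact ⟨hs, fun i => abs_lt.2 (hv i (mem_univ i))⟩
        · rw [indicator_of_notMem hv, indicator_of_notMem]
          exact fun h => hv fun i _ => abs_lt.1 (h.2 i)
      rw [hset, integral_indicator (MeasurableSet.univ_pi fun _ => measurableSet_Ioo)]
      -- Strict dominance gives an open cube, which differs from the closed one by a null set.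
      exact setIntegral_congr_set Measure.pi_Ioo_ae_eq_pi_Icc
    · rw [indicator_of_notMem (by simpa using hs)]
      have : (fun v => V.indicator f (s, v)) = fun _ => 0 := by
        funext v
        exact indicator_of_notMem (fun h => hs h.1) _
      rw [this, integral_zero]
  rw [h1, ← integral_indicator hVm, Measure.volume_eq_prod, integral_prod _
    ((integrable_indicator_iff hVm).2 hVi)]
  simp only [hinner]
  rw [integral_comp_abs, setIntegral_indicator measurableSet_Iic, Ioi_inter_Iic,
    intervalIntegral.integral_of_le hb]

theorem setIntegral_cube_symmetric {n : ℕ} {F : (Fin (n + 1) → ℝ) → ℝ} (hF : Continuous F)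
    (hperm : ∀ (σ : Equiv.Perm (Fin (n + 1))) v, F (v ∘ σ) = F v) (hneg : ∀ v, F (-v) = F v)
    {b : ℝ} (hb : 0 ≤ b) :
    ∫ v in cube (n + 1) (-b) b, F v =
      (n + 1) * (2 * ∫ s in (0 : ℝ)..b, ∫ v in cube n (-s) s, F (Fin.cons (-s) v)) := by
  rw [← setIntegral_congr_set (iUnion_dominantPart_ae_eq n b),
    integral_iUnion_fintype (measurableSet_dominantPart n b) (pairwise_disjoint_dominantPart n b)
      fun j => (integrableOn_cube hF).mono_set (dominantPart_subset_cube n b j)]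
  simp only [setIntegral_dominantPart hF hperm hneg hb]
  simp

/-! ### The determinant on a symmetric interval -/

open scoped Pointwise in
theorem setIntegral_cube_smul {n : ℕ} {z : ℝ} (hz : 0 < z) (g : (Fin n → ℝ) → ℝ) :
    ∫ v in cube n (-1) 1, z ^ n * g (z • v) = ∫ v in cube n (-z) z, g v := by
  have hset : z • cube n (-1) 1 = cube n (-z) z := by
    ext v
    rw [mem_smul_set_iff_inv_smul_mem₀ hz.ne']
    simp only [cube, mem_univ_pi, Pi.smul_apply, smul_eq_mul, mem_Icc]
    refine forall_congr' fun i => ?_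
    rw [inv_mul_le_iff₀ hz, le_inv_mul_iff₀ hz]
    simp
  rw [integral_const_mul, Measure.setIntegral_comp_smul_of_pos volume g _ hz, hset,
    Module.finrank_fin_fun, smul_eq_mul, mul_inv_cancel_left₀ (pow_ne_zero n hz.ne')]

variable (k : ℝ → ℝ → ℝ)

/-- The term of Fredholm's series of the first minor of the interval `[-s, s]` at the endpoint
`-s`. -/
noncomputable def endpointTerm (n : ℕ) (s : ℝ) : ℝ :=
  (-1) ^ n / (n.factorial : ℝ) * ∫ v in cube n (-1) 1,
    s ^ n * kernelDet k (Fin.cons (-s) (s • v) : Fin (n + 1) → ℝ) (Fin.cons (-s) (s • v))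

/-- The first minor of the interval `[-s, s]` at the endpoint `-s`. -/
noncomputable def endpointMinor (s : ℝ) : ℝ := ∑' n, endpointTerm k n s

variable {k}

/-- The terms are defined on a fixed cube so that they are continuous in `s` through `0`; scaling
recovers the minor for `s > 0`. -/
theorem endpointTerm_of_pos (n : ℕ) {s : ℝ} (hs : 0 < s) :
    endpointTerm k n s = minorTerm k (-s) s n (-s) (-s) := by
  rw [endpointTerm, minorTerm, setIntegral_cube_smul hs
    fun v => kernelDet k (Fin.cons (-s) v : Fin (n + 1) → ℝ) (Fin.cons (-s) v)]

theorem endpointMinor_of_pos {s : ℝ} (hs : 0 < s) :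
    endpointMinor k s = fredholmMinor k (-s) s (-s) (-s) := by
  simp only [endpointMinor, fredholmMinor, endpointTerm_of_pos _ hs]

theorem continuous_endpointTerm (hk : Continuous (Function.uncurry k)) (n : ℕ) :
    Continuous (endpointTerm k n) := by
  refine continuous_const.mul (continuous_parametric_integral_of_continuous
    (f := fun s v => s ^ n *
      kernelDet k (Fin.cons (-s) (s • v) : Fin (n + 1) → ℝ) (Fin.cons (-s) (s • v))) ?_
    (isCompact_cube n (-1) 1))
  exact (continuous_fst.pow n).mul
    (continuous_kernelDet hk (continuous_cons (by fun_prop) (by fun_prop))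
      (continuous_cons (by fun_prop) (by fun_prop)))

theorem norm_endpointTerm_le {B : ℝ} (hB : ∀ x y, |k x y| ≤ B) {S s : ℝ} (hs : |s| ≤ S) (n : ℕ) :
    ‖endpointTerm k n s‖ ≤ hadamardBound B (2 * S) n := by
  have hB0 : 0 ≤ B := (abs_nonneg _).trans (hB 0 0)
  have h := norm_setIntegral_le_of_norm_le_const (μ := volume)
    (isCompact_cube n (-1) 1).measure_lt_top (f := fun v => s ^ n *
      kernelDet k (Fin.cons (-s) (s • v) : Fin (n + 1) → ℝ) (Fin.cons (-s) (s • v)))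
    (C := S ^ n * (B * Real.sqrt (n + 1 : ℕ)) ^ (n + 1)) (fun v _ => by
      rw [norm_mul, norm_pow]
      have := abs_kernelDet_le hB (Fin.cons (-s) (s • v) : Fin (n + 1) → ℝ) (Fin.cons (-s) (s • v))
      exact mul_le_mul (pow_le_pow_left₀ (abs_nonneg s) hs n) this (abs_nonneg _)
        (pow_nonneg ((abs_nonneg s).trans hs) n))
  rw [volume_real_cube n (by norm_num)] at h
  rw [endpointTerm, norm_mul, hadamardBound, norm_div, norm_pow]
  simp only [norm_neg, norm_one, one_pow, RCLike.norm_natCast, one_div]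
  calc _ ≤ (n.factorial : ℝ)⁻¹ * (S ^ n * (B * Real.sqrt (n + 1 : ℕ)) ^ (n + 1) *
        (1 - -1) ^ n) := by gcongr
    _ = _ := by
      rw [show (1 : ℝ) - -1 = 2 by norm_num]
      ring

theorem continuous_endpointMinor (hk : Continuous (Function.uncurry k)) {B : ℝ}
    (hB : ∀ x y, |k x y| ≤ B) : Continuous (endpointMinor k) := by
  rw [continuous_iff_continuousAt]
  intro s
  have h : ContinuousOn (endpointMinor k) (Icc (-(|s| + 1)) (|s| + 1)) :=
    continuousOn_tsum (fun n => (continuous_endpointTerm hk n).continuousOn)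
      (summable_hadamardBound B (2 * (|s| + 1)))
      fun n x hx => norm_endpointTerm_le hB (abs_le.2 hx) n
  refine h.continuousAt (Icc_mem_nhds ?_ ?_)
  · linarith [neg_abs_le s]
  · linarith [le_abs_self s]

theorem detTerm_succ_eq_integral (hk : Continuous (Function.uncurry k))
    (hneg : ∀ x y, k (-x) (-y) = k x y) (n : ℕ) {b : ℝ} (hb : 0 ≤ b) :
    detTerm k (-b) b (n + 1) = -2 * ∫ s in (0 : ℝ)..b, endpointTerm k n s := by
  have h := setIntegral_cube_symmetric (n := n) (F := fun v => kernelDet k v v)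
    (continuous_kernelDet hk continuous_id continuous_id)
    (fun σ v => kernelDet_comp_perm k σ v v)
    (fun v => by simp only [kernelDet, Pi.neg_apply, hneg]) hb
  have h2 : ∫ s in (0 : ℝ)..b, endpointTerm k n s = (-1) ^ n / (n.factorial : ℝ) *
      ∫ s in (0 : ℝ)..b, ∫ v in cube n (-s) s,
        kernelDet k (Fin.cons (-s) v : Fin (n + 1) → ℝ) (Fin.cons (-s) v) := by
    rw [← intervalIntegral.integral_const_mul]
    refine intervalIntegral.integral_congr_ae (Eventually.of_forall fun s hs => ?_)
    rw [uIoc_of_le hb] at hs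
    rw [endpointTerm_of_pos n hs.1, minorTerm]
  have hn : ((n : ℝ) + 1) ≠ 0 := by positivity
  have hf : (n.factorial : ℝ) ≠ 0 := by positivity
  rw [h2, detTerm, h, Nat.factorial_succ]
  push_cast
  field_simp
  ring

/-- The integrated form of `d/db det = -2 × (first minor at (-b, -b))`, summed term by term under
Hadamard's bound; the `2` counts the two moving endpoints. -/
theorem fredholmDet_eq_one_sub_integral (hk : Continuous (Function.uncurry k)) {B : ℝ}
    (hB : ∀ x y, |k x y| ≤ B) (hneg : ∀ x y, k (-x) (-y) = k x y) {b : ℝ} (hb : 0 ≤ b) :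
    fredholmDet (-b) b k 1 = 1 - 2 * ∫ s in (0 : ℝ)..b, endpointMinor k s := by
  have hmem : ∀ s ∈ uIoc 0 b, |s| ≤ b := by
    intro s hs
    rw [uIoc_of_le hb] at hs
    rw [abs_of_pos hs.1]
    exact hs.2
  have hint : HasSum (fun n => ∫ s in (0 : ℝ)..b, endpointTerm k n s)
      (∫ s in (0 : ℝ)..b, endpointMinor k s) := by
    refine intervalIntegral.hasSum_integral_of_dominated_convergence
      (fun n _ => hadamardBound B (2 * b) n) (fun n => ?_) (fun n => ?_) ?_ ?_ ?_
    · exact (continuous_endpointTerm hk n).aestronglyMeasurable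
    · exact Eventually.of_forall fun s hs => norm_endpointTerm_le hB (hmem s hs) n
    · exact Eventually.of_forall fun s _ => summable_hadamardBound B (2 * b)
    · exact intervalIntegrable_const
    · exact Eventually.of_forall fun s hs => (Summable.of_norm_bounded
        (summable_hadamardBound B (2 * b)) fun n => norm_endpointTerm_le hB (hmem s hs) n).hasSum
  rw [fredholmDet_one, (summable_detTerm hB (by linarith)).tsum_eq_zero_add, detTerm_zero]
  simp only [detTerm_succ_eq_integral hk hneg _ hb]
  rw [tsum_mul_left, hint.tsum_eq]
  ring

/-! ### Composition of integral operators -/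

section Composition

variable {𝕜 : Type*} [RCLike 𝕜]

theorem integral_kernel_comp {a b : ℝ} (hab : a ≤ b) {p : ℝ → 𝕜} {q : ℝ → ℝ → 𝕜} {f : ℝ → 𝕜}
    (hp : Continuous p) (hq : Continuous (Function.uncurry q))
    (hf : IntegrableOn f (Icc a b)) :
    ∫ t in a..b, p t * ∫ u in a..b, q t u * f u =
      ∫ u in a..b, (∫ t in a..b, p t * q t u) * f u := by
  have hint : Integrable (Function.uncurry fun t u => p t * q t u * f u)
      ((volume.restrict (Icc a b)).prod (volume.restrict (Icc a b))) := by
    rw [Measure.prod_restrict]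
    refine IntegrableOn.continuousOn_mul (g := fun x : ℝ × ℝ => p x.1 * q x.1 x.2)
      (g' := fun x : ℝ × ℝ => f x.2) ?_ ?_ (isCompact_Icc.prod isCompact_Icc)
    · exact ((hp.comp continuous_fst).mul hq).continuousOn
    · rw [IntegrableOn, ← Measure.prod_restrict]
      exact Integrable.comp_snd hf _
  have hswap := integral_integral_swap hint
  simp only [intervalIntegral.integral_of_le hab, ← integral_Icc_eq_integral_Ioc,
    ← integral_const_mul, ← integral_mul_const]
  rw [← hswap]
  simp only [mul_assoc]

end Composition

/-! ### The resolvent kernel on `[-z, z]` -/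

/-- The kernel `sin π(x - y) / (π(x - y))`. -/
noncomputable def unitSine (x y : ℝ) : ℝ := Real.sinc (Real.pi * (x - y))

theorem continuous_unitSine : Continuous (Function.uncurry unitSine) := by
  have := Real.continuous_sinc
  unfold unitSine Function.uncurry
  fun_prop

theorem abs_unitSine_le (x y : ℝ) : |unitSine x y| ≤ 1 := Real.abs_sinc_le_one _

theorem unitSine_comm (x y : ℝ) : unitSine x y = unitSine y x := by
  rw [unitSine, unitSine, ← Real.sinc_neg]
  ring_nf

theorem unitSine_neg (x y : ℝ) : unitSine (-x) (-y) = unitSine x y := by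
  rw [unitSine, unitSine, ← Real.sinc_neg]
  ring_nf

theorem sineKernel_eq (z x y : ℝ) : sineKernel z x y = z * unitSine (z * x) (z * y) := by
  rw [sineKernel, unitSine]
  ring_nf

/-- The projection of the real line to `[-1, 1]`. -/
noncomputable def proj : ℝ → 𝕁 := projIcc (-1) 1 (by norm_num)

theorem continuous_proj : Continuous proj := continuous_projIcc

theorem proj_coe (x : 𝕁) : proj x = x := projIcc_val _ x

theorem coe_proj_div {z x : ℝ} (hz : 0 < z) (hx : x ∈ Icc (-z) z) : z * (proj (x / z) : ℝ) = x := by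
  have h : x / z ∈ Icc (-1 : ℝ) 1 := by
    rw [mem_Icc, le_div_iff₀ hz, div_le_iff₀ hz]
    simpa using hx
  rw [proj, projIcc_of_mem _ h]
  field_simp

/-- The resolvent kernel of the sine kernel on `[-z, z]`. -/
noncomputable def sineResolventKernel (z x y : ℝ) : ℝ :=
  z⁻¹ * resolventSection z (proj (y / z)) (proj (x / z))

/-- Clamping by `proj` gives continuity on the whole plane; the resolvent equations hold only on the
square. -/
theorem continuous_sineResolventKernel (z : ℝ) :
    Continuous (Function.uncurry (sineResolventKernel z)) := by
  have h : Continuous fun p : ℝ × ℝ => (resolventSection z (proj (p.2 / z)), proj (p.1 / z)) :=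
    ((continuous_resolventSection z).comp (continuous_proj.comp (by fun_prop))).prodMk
      (continuous_proj.comp (by fun_prop))
  exact continuous_const.mul (IntervalFun.continuous_apply.comp h)

theorem sineResolventKernel_comm (z x y : ℝ) :
    sineResolventKernel z x y = sineResolventKernel z y x := by
  rw [sineResolventKernel, resolventSection_comm, sineResolventKernel]

/-- Substitution `s = zt`; the Jacobian cancels the `z⁻¹` in the kernel. -/
theorem integral_mul_resolventSection {𝕜 : Type*} [RCLike 𝕜] {z : ℝ} (hz : 0 < z) (y : ℝ)
    (g : ℝ → 𝕜) :
    ∫ s in (-z)..z, g s * (sineResolventKernel z s y : 𝕜) =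
      ∫ t : 𝕁, g (z * t) * (resolventSection z (proj (y / z)) t : 𝕜) := by
  have h := integral_interval_eq fun t : ℝ => g (z * t) *
    (resolventSection z (proj (y / z)) (proj t) : 𝕜)
  simp only [proj_coe] at h
  rw [h]
  have h2 := intervalIntegral.integral_comp_mul_left (a := -1) (b := 1)
    (fun s => g s * (resolventSection z (proj (y / z)) (proj (s / z)) : 𝕜)) hz.ne'
  have h3 : ∀ t : ℝ, z * t / z = t := fun t => by field_simp
  simp only [h3, mul_neg, mul_one] at h2
  rw [h2, ← intervalIntegral.integral_smul]
  refine intervalIntegral.integral_congr fun s _ => ?_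
  simp only [sineResolventKernel]
  rw [RCLike.real_smul_eq_coe_mul]
  push_cast
  ring

theorem sineResolventKernel_eq {z x y : ℝ} (hz : 0 < z) (hx : x ∈ Icc (-z) z)
    (hy : y ∈ Icc (-z) z) :
    sineResolventKernel z x y =
      unitSine x y + ∫ s in (-z)..z, unitSine x s * sineResolventKernel z s y := by
  have h := integral_mul_resolventSection (𝕜 := ℝ) hz y (unitSine x)
  simp only [RCLike.ofReal_real_eq_id, id] at h
  rw [h, sineResolventKernel, resolventSection_apply, sineKernel_eq, coe_proj_div hz hx,
    coe_proj_div hz hy, IntervalFun.pairing_apply, mul_add, inv_mul_cancel_left₀ hz.ne',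
    unitSine_comm y x, ← integral_const_mul]
  congr 2 with t
  rw [kernelSection_apply, sineKernel_eq, coe_proj_div hz hx, ← mul_assoc,
    inv_mul_cancel_left₀ hz.ne']

theorem sineResolventKernel_eq_resolvent_mul {z x y : ℝ} (hz : 0 < z) (hx : x ∈ Icc (-z) z)
    (hy : y ∈ Icc (-z) z) :
    sineResolventKernel z x y =
      unitSine x y + ∫ s in (-z)..z, sineResolventKernel z x s * unitSine s y := by
  rw [sineResolventKernel_comm, sineResolventKernel_eq hz hy hx, unitSine_comm]
  congr 1
  refine intervalIntegral.integral_congr fun s _ => ?_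
  rw [unitSine_comm, sineResolventKernel_comm, mul_comm]

/-- A solution of the integral equation `M = D k(·, y) + K M` is `D` times the resolvent
kernel. -/
theorem eq_mul_of_resolvent {a b x y D : ℝ} (hx : x ∈ Icc a b) (hy : y ∈ Icc a b)
    {k : ℝ → ℝ → ℝ} {R M : ℝ → ℝ} (hk : Continuous (Function.uncurry k)) (hRc : Continuous R)
    (hMc : Continuous M) (hM : ∀ t, M t = D * k t y + ∫ s in a..b, k t s * M s)
    (hR : ∀ u ∈ Icc a b, R u = k x u + ∫ t in a..b, R t * k t u) : M x = D * R y := by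
  have hab : a ≤ b := hx.1.trans hx.2
  have hkx : Continuous (k x) := hk.comp (by fun_prop : Continuous fun s => (x, s))
  have hky : Continuous fun t => k t y := hk.comp (by fun_prop : Continuous fun t => (t, y))
  have hI : Continuous fun t => ∫ s in a..b, k t s * M s := by
    have : (fun t => ∫ s in a..b, k t s * M s) = fun t => M t - D * k t y := by
      funext t
      rw [hM t]
      ring
    rw [this]
    exact hMc.sub (continuous_const.mul hky)
  -- The equation for `M` is integrated against the resolvent row `R`; after Fubini, `RK` is
  -- replaced by `R - k(x, ·)` and the integrals of `R M` cancel.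
  have h1 : ∫ t in a..b, R t * M t =
      D * (∫ t in a..b, R t * k t y) + ∫ t in a..b, R t * ∫ s in a..b, k t s * M s := by
    rw [← intervalIntegral.integral_const_mul, ← intervalIntegral.integral_add
      (f := fun t => D * (R t * k t y)) (g := fun t => R t * ∫ s in a..b, k t s * M s)
      ((continuous_const.mul (hRc.mul hky)).intervalIntegrable _ _)
      ((hRc.mul hI).intervalIntegrable _ _)]
    refine intervalIntegral.integral_congr fun t _ => ?_
    have := hM t
    linear_combination R t * this
  rw [integral_kernel_comp hab hRc hk
    (hMc.continuousOn.integrableOn_compact isCompact_Icc)] at h1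
  have h2 : ∫ u in a..b, (∫ t in a..b, R t * k t u) * M u =
      (∫ u in a..b, R u * M u) - ∫ u in a..b, k x u * M u := by
    rw [← intervalIntegral.integral_sub (f := fun u => R u * M u)
      (g := fun u => k x u * M u) ((hRc.mul hMc).intervalIntegrable _ _)
      ((hkx.mul hMc).intervalIntegrable _ _)]
    refine intervalIntegral.integral_congr fun u hu => ?_
    rw [uIcc_of_le hab] at hu
    linear_combination (-M u) * hR u hu
  linear_combination hM x - D * hR y hy + h1 + h2

/-- The first minor is the determinant times the resolvent kernel. -/
theorem fredholmMinor_unitSine {z x y : ℝ} (hz : 0 < z) (hx : x ∈ Icc (-z) z)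
    (hy : y ∈ Icc (-z) z) :
    fredholmMinor unitSine (-z) z x y =
      fredholmDet (-z) z unitSine 1 * sineResolventKernel z x y := by
  have hzz : -z ≤ z := by linarith
  have hM : Continuous fun x => fredholmMinor unitSine (-z) z x y :=
    continuous_fredholmMinor continuous_unitSine abs_unitSine_le hzz y
  have hR : Continuous (sineResolventKernel z x) :=
    (continuous_sineResolventKernel z).uncurry_left x
  exact eq_mul_of_resolvent hx hy continuous_unitSine hR hM
    (fun t => fredholmMinor_eq continuous_unitSine abs_unitSine_le hzz t y)
    (fun u hu => sineResolventKernel_eq_resolvent_mul hz hx hu)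

/-! ### The operator `C_z` and its inverse -/

theorem integrableOn_of_memLp_two {a b : ℝ} {f : ℝ → ℂ}
    (hf : MemLp f 2 (volume.restrict (Icc a b))) : IntegrableOn f (Icc a b) :=
  hf.integrable (by norm_num)

theorem intOp_congr_ae {z : ℝ} (hz : 0 < z) (k : ℝ → ℝ → ℂ) {f g : ℝ → ℂ}
    (h : f =ᵐ[volume.restrict (Icc (-z) z)] g) (x : ℝ) : intOp z k f x = intOp z k g x := by
  have hzz : -z ≤ z := by linarith
  simp only [intOp, intervalIntegral.integral_of_le hzz, ← integral_Icc_eq_integral_Ioc]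
  refine integral_congr_ae ?_
  filter_upwards [h] with y hy
  rw [hy]

theorem intervalIntegrable_of_integrableOn {a b : ℝ} (hab : a ≤ b) {f : ℝ → ℂ}
    (hf : IntegrableOn f (Icc a b)) : IntervalIntegrable f volume a b :=
  (intervalIntegrable_iff_integrableOn_Icc_of_le hab).2 hf

theorem integrableOn_kernel_mul {z x : ℝ} {k : ℝ → ℝ → ℂ} (hk : Continuous (Function.uncurry k))
    {f : ℝ → ℂ} (hf : IntegrableOn f (Icc (-z) z)) :
    IntegrableOn (fun y => k x y * f y) (Icc (-z) z) :=
  hf.continuousOn_mul (hk.comp (by fun_prop : Continuous fun y => (x, y))).continuousOn isCompact_Icc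

theorem continuous_intOp {z : ℝ} {k : ℝ → ℝ → ℂ} (hk : Continuous (Function.uncurry k))
    {f : ℝ → ℂ} (hz : 0 < z) (hf : IntegrableOn f (Icc (-z) z)) :
    ContinuousOn (intOp z k f) (Icc (-z) z) := by
  have hzz : -z ≤ z := by linarith
  obtain ⟨C, hC⟩ := (isCompact_Icc (a := -z) (b := z)).prod (isCompact_Icc (a := -z) (b := z))
    |>.exists_bound_of_continuousOn hk.continuousOn
  intro x₀ hx₀
  refine intervalIntegral.continuousWithinAt_of_dominated_interval (bound := fun y => C * ‖f y‖)
    (eventually_nhdsWithin_of_forall fun x _ => ?_)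
    (eventually_nhdsWithin_of_forall fun x hx => ?_) ?_ ?_
  · exact (intervalIntegrable_of_integrableOn hzz
      (integrableOn_kernel_mul hk hf)).def'.aestronglyMeasurable
  · refine Eventually.of_forall fun y hy => ?_
    rw [uIoc_of_le hzz] at hy
    rw [norm_mul]
    exact mul_le_mul_of_nonneg_right (hC (x, y) ⟨hx, Ioc_subset_Icc_self hy⟩) (norm_nonneg _)
  · exact (intervalIntegrable_of_integrableOn hzz hf).norm.const_mul C
  · refine Eventually.of_forall fun y _ => ?_
    exact ((hk.uncurry_right y).mul continuous_const).continuousWithinAt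

theorem intOp_add {z x : ℝ} (hz : 0 < z) {k : ℝ → ℝ → ℂ} (hk : Continuous (Function.uncurry k))
    {f g : ℝ → ℂ} (hf : IntegrableOn f (Icc (-z) z)) (hg : IntegrableOn g (Icc (-z) z)) :
    intOp z k (fun y => f y + g y) x = intOp z k f x + intOp z k g x := by
  have hzz : -z ≤ z := by linarith
  simp only [intOp, mul_add]
  exact intervalIntegral.integral_add
    (intervalIntegrable_of_integrableOn hzz (integrableOn_kernel_mul hk hf))
    (intervalIntegrable_of_integrableOn hzz (integrableOn_kernel_mul hk hg))

theorem intOp_sub {z x : ℝ} (hz : 0 < z) {k : ℝ → ℝ → ℂ} (hk : Continuous (Function.uncurry k))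
    {f g : ℝ → ℂ} (hf : IntegrableOn f (Icc (-z) z)) (hg : IntegrableOn g (Icc (-z) z)) :
    intOp z k (fun y => f y - g y) x = intOp z k f x - intOp z k g x := by
  have hzz : -z ≤ z := by linarith
  simp only [intOp, mul_sub]
  exact intervalIntegral.integral_sub
    (intervalIntegrable_of_integrableOn hzz (integrableOn_kernel_mul hk hf))
    (intervalIntegrable_of_integrableOn hzz (integrableOn_kernel_mul hk hg))

/-- Composition of integral operators whose composed kernel is a difference of two kernels. -/
theorem intOp_intOp {z x : ℝ} (hz : 0 < z) {p q r s : ℝ → ℝ → ℂ}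
    (hp : Continuous (Function.uncurry p)) (hq : Continuous (Function.uncurry q))
    (hr : Continuous (Function.uncurry r)) (hs : Continuous (Function.uncurry s))
    (h : ∀ u ∈ Icc (-z) z, ∫ t in (-z)..z, p x t * q t u = r x u - s x u)
    {f : ℝ → ℂ} (hf : IntegrableOn f (Icc (-z) z)) :
    intOp z p (intOp z q f) x = intOp z r f x - intOp z s f x := by
  have hzz : -z ≤ z := by linarith
  have h1 := integral_kernel_comp (𝕜 := ℂ) hzz
    (hp.comp (by fun_prop : Continuous fun t => (x, t))) hq hf
  simp only [Function.comp_def, Function.uncurry] at h1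
  unfold intOp
  rw [h1, ← intervalIntegral.integral_sub
    (intervalIntegrable_of_integrableOn hzz (integrableOn_kernel_mul hr hf))
    (intervalIntegrable_of_integrableOn hzz (integrableOn_kernel_mul hs hf))]
  refine intervalIntegral.integral_congr fun u hu => ?_
  rw [uIcc_of_le hzz] at hu
  simp only [h u hu, sub_mul]

/-- The complexification of a real kernel. -/
noncomputable def complexify (k : ℝ → ℝ → ℝ) (x y : ℝ) : ℂ := (k x y : ℂ)

theorem continuous_complexify {k : ℝ → ℝ → ℝ} (hk : Continuous (Function.uncurry k)) :
    Continuous (Function.uncurry (complexify k)) :=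
  Complex.continuous_ofReal.comp hk

theorem integral_complexify (k l : ℝ → ℝ → ℝ) (a b x u : ℝ) :
    ∫ t in a..b, complexify k x t * complexify l t u = ((∫ t in a..b, k x t * l t u : ℝ) : ℂ) := by
  rw [← intervalIntegral.integral_ofReal]
  simp [complexify]

theorem sineOp_eq (z : ℝ) (f : ℝ → ℂ) (x : ℝ) :
    sineOp z f x = f x - intOp z (complexify unitSine) f x := rfl

/-- The two resolvent equations say `KQ = QK = Q - K`, that is, `1 + Q` inverts `1 - K` on both
sides. -/
theorem isSineResolventKernel_complexify {z : ℝ} (hz : 0 < z) :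
    IsSineResolventKernel z (complexify (sineResolventKernel z)) := by
  have hk := continuous_complexify continuous_unitSine
  have hQ := continuous_complexify (continuous_sineResolventKernel z)
  refine ⟨hQ.continuousOn, fun f hf => ?_, fun f hf => ?_⟩
  · have hf := integrableOn_of_memLp_two hf
    refine ae_restrict_of_forall_mem measurableSet_Icc fun x hx => ?_
    rw [sineOp_eq, intOp_add hz hk hf
      ((continuous_intOp hQ hz hf).integrableOn_compact isCompact_Icc),
      intOp_intOp hz hk hQ hQ hk (fun u hu => ?_) hf]
    · ring
    · rw [integral_complexify, complexify, complexify, sineResolventKernel_eq hz hx hu]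
      push_cast
      ring
  · have hf := integrableOn_of_memLp_two hf
    refine ae_restrict_of_forall_mem measurableSet_Icc fun x hx => ?_
    have h := intOp_sub (x := x) hz hQ hf
      ((continuous_intOp hk hz hf).integrableOn_compact isCompact_Icc)
    rw [intOp_intOp hz hQ hk hQ hk (fun u hu => ?_) hf] at h
    · have hS : sineOp z f = fun y => f y - intOp z (complexify unitSine) f y := rfl
      rw [hS, h]
      ring
    · rw [integral_complexify, complexify, complexify, sineResolventKernel_eq_resolvent_mul hz hx hu]
      push_cast
      ring

theorem isSineResolventKernel_sineResolvent {z : ℝ} (hz : 0 < z) :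
    IsSineResolventKernel z (sineResolvent z) := by
  have h : ∃ Q : ℝ → ℝ → ℂ, IsSineResolventKernel z Q := ⟨_, isSineResolventKernel_complexify hz⟩
  rw [sineResolvent, dif_pos h]
  exact h.choose_spec

/-! ### Uniqueness of the resolvent kernel's action -/

theorem _root_.IsSineResolventKernel.continuousOn_intOp {z : ℝ} (hz : 0 < z) {Q : ℝ → ℝ → ℂ}
    (hQ : IsSineResolventKernel z Q) {f : ℝ → ℂ} (hf : IntegrableOn f (Icc (-z) z)) :
    ContinuousOn (intOp z Q f) (Icc (-z) z) := by
  have hzz : -z ≤ z := by linarith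
  let P : ℝ → ℝ := fun x => projIcc (-z) z hzz x
  have hP : Continuous P := continuous_subtype_val.comp continuous_projIcc
  have hPx : ∀ x ∈ Icc (-z) z, P x = x := fun x hx => by simp [P, projIcc_of_mem hzz hx]
  have hc : Continuous (Function.uncurry fun x y => Q (P x) (P y)) :=
    hQ.continuousOn.comp_continuous ((hP.comp continuous_fst).prodMk (hP.comp continuous_snd))
      fun p => ⟨(projIcc (-z) z hzz p.1).2, (projIcc (-z) z hzz p.2).2⟩
  refine (continuous_intOp hc hz hf).congr fun x hx => ?_
  refine intervalIntegral.integral_congr fun y hy => ?_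
  rw [uIcc_of_le hzz] at hy
  simp only [hPx x hx, hPx y hy]

/-- A left inverse equals a right inverse. This makes `r` independent of the chosen kernel. -/
theorem _root_.IsSineResolventKernel.intOp_eqOn {z : ℝ} (hz : 0 < z) {Q R : ℝ → ℝ → ℂ}
    (hQ : IsSineResolventKernel z Q) (hR : IsSineResolventKernel z R) {f : ℝ → ℂ}
    (hf : Continuous f) : EqOn (intOp z Q f) (intOp z R f) (Icc (-z) z) := by
  have hfi : IntegrableOn f (Icc (-z) z) := hf.continuousOn.integrableOn_compact isCompact_Icc
  have hmem : ∀ {g : ℝ → ℂ}, ContinuousOn g (Icc (-z) z) →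
      MemLp g 2 (volume.restrict (Icc (-z) z)) := by
    intro g hg
    obtain ⟨C, hC⟩ := isCompact_Icc.exists_bound_of_continuousOn hg
    exact MemLp.of_bound (hg.aestronglyMeasurable measurableSet_Icc) C
      (ae_restrict_of_forall_mem measurableSet_Icc hC)
  have hRc := hR.continuousOn_intOp hz hfi
  have h1 := hR.right_inv f (hmem hf.continuousOn)
  have h2 := hQ.left_inv _ (hmem (hf.continuousOn.add hRc))
  -- Continuity upgrades almost everywhere to everywhere, which is needed because `r` uses the
  -- single point `-z`.
  refine Measure.eqOn_Icc_of_ae_eq volume (by linarith) ?_ (hQ.continuousOn_intOp hz hfi) hRc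
  filter_upwards [h1, h2] with x hx1 hx2
  have h3 := intOp_congr_ae hz Q h1 x
  have h4 : f x + intOp z Q f x = f x + intOp z R f x := by
    rw [← h3]
    nth_rewrite 1 [← hx1]
    exact hx2
  exact add_left_cancel h4

/-! ### The function `r` -/

/-- The left endpoint of `[-1, 1]`. -/
def leftEnd : 𝕁 := ⟨-1, by norm_num⟩

/-- The value of the resolvent kernel on `[-1, 1]` at the left endpoint. -/
noncomputable def endpointResolvent (z : ℝ) : ℝ := resolventSection z leftEnd leftEnd

/-- The derivative of `endpointResolvent`. -/
noncomputable def endpointDeriv (z : ℝ) : ℝ :=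
  (cosCurve z leftEnd + IntervalFun.pairing (cosCurve z) (resolventSection z leftEnd)) ^ 2 +
    (sinCurve z leftEnd + IntervalFun.pairing (sinCurve z) (resolventSection z leftEnd)) ^ 2

theorem hasDerivAt_endpointResolvent (z : ℝ) :
    HasDerivAt endpointResolvent (endpointDeriv z) z :=
  hasDerivAt_resolventSection_diag z leftEnd

theorem endpointDeriv_nonneg (z : ℝ) : 0 ≤ endpointDeriv z := by
  unfold endpointDeriv
  positivity

theorem endpointResolvent_zero : endpointResolvent 0 = 0 := by
  rw [endpointResolvent, resolventSection_zero, IntervalFun.zero_apply]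

theorem differentiable_endpointResolvent : Differentiable ℝ endpointResolvent := fun z =>
  (hasDerivAt_endpointResolvent z).differentiableAt

/-- A nonnegative derivative of a continuous function is integrable, so no continuity of
`endpointDeriv` is needed. -/
theorem integrableOn_endpointDeriv (z : ℝ) : IntegrableOn endpointDeriv (Ioc 0 z) :=
  intervalIntegral.integrableOn_deriv_of_nonneg
    differentiable_endpointResolvent.continuous.continuousOn
    (fun x _ => hasDerivAt_endpointResolvent x) fun x _ => endpointDeriv_nonneg x

theorem integral_endpointDeriv {z : ℝ} (hz : 0 ≤ z) :
    ∫ s in (0 : ℝ)..z, endpointDeriv s = endpointResolvent z := by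
  rw [intervalIntegral.integral_eq_sub_of_hasDerivAt_of_le hz
    differentiable_endpointResolvent.continuous.continuousOn
    (fun x _ => hasDerivAt_endpointResolvent x)
    ((intervalIntegrable_iff_integrableOn_Ioc_of_le hz).2 (integrableOn_endpointDeriv z)),
    endpointResolvent_zero, sub_zero]

theorem proj_neg_div_self {z : ℝ} (hz : 0 < z) : proj (-z / z) = leftEnd := by
  rw [neg_div, div_self hz.ne']
  exact projIcc_left (a := (-1 : ℝ)) (b := 1) (h := by norm_num)

theorem neg_mem_Icc {z : ℝ} (hz : 0 < z) : -z ∈ Icc (-z) z := ⟨le_rfl, by linarith⟩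

/-- After scaling, `r(z)` is `(1 - A(z))⁻¹` applied to `e^{-iπzt} = cos zπt - i sin zπt`, evaluated
at `t = -1`. -/
theorem sineR_eq {z : ℝ} (hz : 0 < z) : sineR z =
    ((cosCurve z leftEnd + IntervalFun.pairing (cosCurve z) (resolventSection z leftEnd) : ℝ) : ℂ) -
      ((sinCurve z leftEnd + IntervalFun.pairing (sinCurve z) (resolventSection z leftEnd) : ℝ) : ℂ)
        * Complex.I := by
  set g := resolventSection z leftEnd with hg
  have h1 : ∫ s in (-z)..z, sineResolvent z (-z) s * Complex.exp (-(Complex.I * s * Real.pi)) =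
      ∫ s in (-z)..z, Complex.exp (-(Complex.I * s * Real.pi)) *
        (sineResolventKernel z s (-z) : ℂ) := by
    have h := (isSineResolventKernel_sineResolvent hz).intOp_eqOn hz
      (isSineResolventKernel_complexify hz)
      (f := fun s : ℝ => Complex.exp (-(Complex.I * s * Real.pi))) (by fun_prop) (neg_mem_Icc hz)
    refine Eq.trans h (intervalIntegral.integral_congr fun s _ => ?_)
    simp only [complexify]
    rw [sineResolventKernel_comm, mul_comm]
  have h2 := integral_mul_resolventSection (𝕜 := ℂ) hz (-z)
    (fun s : ℝ => Complex.exp (-(Complex.I * s * Real.pi)))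
  rw [proj_neg_div_self hz] at h2
  have h3 : ∫ t : 𝕁, Complex.exp (-(Complex.I * ((z * t : ℝ) : ℂ) * Real.pi)) *
      (g t : ℂ) = fourierLaplace g ((-z : ℝ) : ℂ) := by
    rw [fourierLaplace]
    congr 1 with t
    rw [mul_comm]
    congr 2
    push_cast
    ring
  have hcos : cosCurve (-z) = cosCurve z := by
    ext x
    simp [Real.cos_neg]
  have hsin : sinCurve (-z) = -sinCurve z := by
    ext x
    simp [Real.sin_neg]
  have h4 : Complex.exp (Complex.I * z * Real.pi) =
      (cosCurve z leftEnd : ℂ) - (sinCurve z leftEnd : ℂ) * Complex.I := by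
    rw [show Complex.I * z * Real.pi = ((z * Real.pi : ℝ) : ℂ) * Complex.I by push_cast; ring,
      Complex.exp_mul_I]
    simp [leftEnd]
  rw [sineR, h1]
  erw [h2]
  rw [← hg]
  erw [h3]
  rw [fourierLaplace_ofReal, hcos, hsin, h4]
  simp only [map_neg, neg_apply]
  push_cast
  ring

theorem norm_sineR_sq {z : ℝ} (hz : 0 < z) : ‖sineR z ^ 2‖ = endpointDeriv z := by
  rw [norm_pow, ← Complex.normSq_eq_norm_sq, sineR_eq hz, Complex.normSq_apply, endpointDeriv]
  simp only [Complex.sub_re, Complex.ofReal_re, Complex.mul_re, Complex.I_re, Complex.ofReal_im,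
    Complex.I_im, Complex.sub_im, Complex.mul_im]
  ring

/-! ### The logarithmic derivative of the determinant -/

/-- Scaling the variables by `z` absorbs the factor `zⁿ` that the kernel contributes to each
determinant. -/
theorem sineDet_one {z : ℝ} (hz : 0 < z) : sineDet z 1 = fredholmDet (-z) z unitSine 1 := by
  rw [sineDet, fredholmDet_one, fredholmDet_one]
  congr 1 with n
  rw [detTerm, detTerm, ← setIntegral_cube_smul hz fun v => kernelDet unitSine v v]
  congr 2 with v
  have h : (Matrix.of fun i j : Fin n => sineKernel z (v i) (v j)) =
      z • Matrix.of fun i j : Fin n => unitSine ((z • v) i) ((z • v) j) := by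
    ext i j
    simp [sineKernel_eq]
  rw [kernelDet, h, Matrix.det_smul, Fintype.card_fin, kernelDet]

/-- The diagonal value at the endpoint of the resolvent kernel on `[-z, z]`. -/
noncomputable def endpointDensity : ℝ → ℝ := dslope endpointResolvent 0

/-- The singularity of `T_z(-1, -1) / z` at `0` is removable, since the numerator vanishes there and
is differentiable. -/
theorem continuous_endpointDensity : Continuous endpointDensity := by
  rw [← continuousOn_univ, endpointDensity, continuousOn_dslope univ_mem]
  exact ⟨differentiable_endpointResolvent.continuous.continuousOn,
    differentiable_endpointResolvent 0⟩

theorem mul_endpointDensity {z : ℝ} (hz : z ≠ 0) : z * endpointDensity z = endpointResolvent z := by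
  rw [endpointDensity, dslope_of_ne _ hz, slope_def_field, endpointResolvent_zero]
  field_simp
  ring

/-- The determinant on `[-z, z]`, extended to all real `z`. -/
noncomputable def detExtension (z : ℝ) : ℝ := 1 - 2 * ∫ s in (0 : ℝ)..z, endpointMinor unitSine s

theorem sineDet_one_eq {z : ℝ} (hz : 0 < z) : sineDet z 1 = detExtension z := by
  rw [sineDet_one hz, detExtension, fredholmDet_eq_one_sub_integral continuous_unitSine
    abs_unitSine_le unitSine_neg hz.le]

theorem endpointMinor_eq {z : ℝ} (hz : 0 < z) :
    endpointMinor unitSine z = detExtension z * endpointDensity z := by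
  rw [endpointMinor_of_pos hz, fredholmMinor_unitSine hz (neg_mem_Icc hz) (neg_mem_Icc hz),
    ← sineDet_one hz, sineDet_one_eq hz, sineResolventKernel, proj_neg_div_self hz]
  congr 1
  rw [← mul_left_cancel_iff_of_pos hz, mul_inv_cancel_left₀ hz.ne', mul_endpointDensity hz.ne']
  rfl

theorem hasDerivAt_detExtension (z : ℝ) :
    HasDerivAt detExtension (-(2 * endpointMinor unitSine z)) z := by
  have hc : Continuous (endpointMinor unitSine) :=
    continuous_endpointMinor continuous_unitSine abs_unitSine_le
  exact ((hc.integral_hasStrictDerivAt 0 z).hasDerivAt.const_mul 2).const_sub 1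

/-- With `q` the endpoint density, `D' = -2qD` on `(0, z)` and `D(0) = 1`. The mean value theorem
shows that `D exp(2∫q)` is `1` at `z`, using the equation only at an interior point. -/
theorem detExtension_pos {z : ℝ} (hz : 0 < z) : 0 < detExtension z := by
  let Φ : ℝ → ℝ := fun b => detExtension b * Real.exp (2 * ∫ s in (0 : ℝ)..b, endpointDensity s)
  have hΦ : ∀ b, HasDerivAt Φ ((-(2 * endpointMinor unitSine b)) *
      Real.exp (2 * ∫ s in (0 : ℝ)..b, endpointDensity s) + detExtension b *
        (Real.exp (2 * ∫ s in (0 : ℝ)..b, endpointDensity s) * (2 * endpointDensity b))) b :=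
    fun b => (hasDerivAt_detExtension b).mul
      (((continuous_endpointDensity.integral_hasStrictDerivAt 0 b).hasDerivAt.const_mul 2).exp)
  obtain ⟨c, hc, hslope⟩ := exists_hasDerivAt_eq_slope Φ _ hz
    (fun b _ => (hΦ b).continuousAt.continuousWithinAt) fun b _ => hΦ b
  rw [endpointMinor_eq hc.1, eq_div_iff (by linarith)] at hslope
  have h0 : Φ 0 = 1 := by simp [Φ, detExtension]
  have h1 : Φ z = 1 := by
    rw [h0] at hslope
    linear_combination -hslope
  exact pos_of_mul_pos_left (by rw [show detExtension z * _ = Φ z from rfl, h1]; norm_num)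
    (Real.exp_pos _).le

end SineKernel

open SineKernel MeasureTheory Set Filter Topology

theorem corollary4p7 (ζ : ℝ) (hζ : 0 < ζ) :
    IsSineResolventKernel ζ (sineResolvent ζ) ∧
    0 < sineDet ζ 1 ∧
    DifferentiableAt ℝ (fun z : ℝ => Real.log (sineDet z 1)) ζ ∧
    IntervalIntegrable (fun s : ℝ => ‖sineR s ^ 2‖) volume 0 ζ ∧
    ζ * deriv (fun z : ℝ => Real.log (sineDet z 1)) ζ = -(2 * ∫ s in (0 : ℝ)..ζ, ‖sineR s ^ 2‖) := by
  have hpos : 0 < detExtension ζ := detExtension_pos hζ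
  have hev : (fun z : ℝ => Real.log (sineDet z 1)) =ᶠ[𝓝 ζ] fun z => Real.log (detExtension z) := by
    filter_upwards [Ioi_mem_nhds hζ] with z hz
    rw [sineDet_one_eq hz]
  have hlog : HasDerivAt (fun z : ℝ => Real.log (sineDet z 1)) (-(2 * endpointDensity ζ)) ζ := by
    refine (((hasDerivAt_detExtension ζ).log hpos.ne').congr_of_eventuallyEq hev).congr_deriv ?_
    rw [endpointMinor_eq hζ]
    field_simp
  -- The identity is known only for `s > 0`; the endpoint `0` is null.
  have hr : EqOn (fun s : ℝ => ‖sineR s ^ 2‖) endpointDeriv (Ioc 0 ζ) := fun s hs =>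
    norm_sineR_sq hs.1
  have hint : ∫ s in (0 : ℝ)..ζ, ‖sineR s ^ 2‖ = endpointResolvent ζ := by
    rw [← integral_endpointDeriv hζ.le]
    refine intervalIntegral.integral_congr_ae (Eventually.of_forall fun s hs => ?_)
    rw [uIoc_of_le hζ.le] at hs
    exact hr hs
  refine ⟨isSineResolventKernel_sineResolvent hζ, by rwa [sineDet_one_eq hζ],
    hlog.differentiableAt, ?_, ?_⟩
  · rw [intervalIntegrable_iff_integrableOn_Ioc_of_le hζ.le]
    exact (integrableOn_congr_fun hr measurableSet_Ioc).2 (integrableOn_endpointDeriv ζ)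
  -- The factor `ζ` turns `Q_ζ(-ζ, -ζ)` into `T_ζ(-1, -1)`, which is the integral of `|r²|`.
  · rw [hlog.deriv, hint, ← mul_endpointDensity hζ.ne']
    ring
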